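/- Let $F$ be a $\sigma$-finite measure on $\mathbb R$ that is not concentrated at a single point, and let $\Omega=(\underline\xi,\bar\xi)$, $-\infty\le\underline\xi<\bar\xi\le\infty$, be an open interval such that $\int e^{\xi x}\,dF(x)<\infty$ for all $\xi\in\Omega$. Put $b(\xi)=\log\int e^{\xi x}\,dF(x)$ and $f_\xi(x)=\exp(\xi x-b(\xi))$ for $\xi\in\Omega$, and let $\mathbf P_\xi,\mathbf E_\xi$ denote probability and expectation when $X_1,X_2,\dots$ are independent and identically distributed with density $f_\xi$ with respect to $F$. Let $\underline\xi<\theta_0<\theta_1<\lambda<\bar\xi$, let $I(\lambda,\theta)=\mathbf E_\lambda\log\frac{f_\lambda(X_1)}{f_\theta(X_1)}$, and for $a>0$ define $$M(a)=\inf\Big\{n\ge1:\ \sum_{i=1}^n\log\frac{f_\lambda(X_i)}{f_\theta(X_i)}\ge I(\lambda,\theta)\,a\ \text{ for all }\theta_0\le\theta\le\theta_1\Big\},\qquad \inf\emptyset=\infty .$$ Then for every $a>0$ and every $\theta\in[\theta_0,\theta_1]$, $$\frac{|\log\mathbf P_\theta(M(a)<\infty)|}{I(\lambda,\theta)}\ \ge\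 a,$$ and as $a\to\infty$ (through real values), $\mathbf E_\lambda M(a)$ is finite for all sufficiently large $a$ and $$\mathbf E_\lambda M(a)=a+(C+o(1))\sqrt a,$$ where $$C=\left(\frac{\lambda-\theta_1}{I(\lambda,\theta_1)}-\frac{\lambda-\theta_0}{I(\lambda,\theta_0)}\right)\sqrt{\frac{b''(\lambda)}{2\pi}}>0 .$$ -/

import Mathlib

open MeasureTheory ProbabilityTheory Filter Topology
open scoped ENNReal

noncomputable section

namespace ExpFamily

/-- The natural parameter set `{ξ | ∫ exp (ξ x) dF(x) < ∞}` of the exponential family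
generated by the measure `F` on the real line. -/
def naturalParameters (F : Measure ℝ) : Set ℝ := integrableExpSet id F

/-- The normalising function `b(ξ) = log ∫ exp (ξ x) dF(x)`. -/
def b (F : Measure ℝ) (ξ : ℝ) : ℝ := cgf id F ξ

/-- The density `f_ξ(x) = exp (ξ x - b(ξ))` with respect to `F`. -/
def density (F : Measure ℝ) (ξ x : ℝ) : ℝ := Real.exp (ξ * x - b F ξ)

/-- The law of one observation under the parameter `ξ`: density `f_ξ` with respect to `F`. -/
def law (F : Measure ℝ) (ξ : ℝ) : Measure ℝ :=
  F.withDensity fun x => ENNReal.ofReal (density F ξ x)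

/-- `f_ξ` is a probability density for every natural parameter `ξ` (if `F ≠ 0`). -/
theorem isProbabilityMeasure_law (F : Measure ℝ) (hF : F ≠ 0) {ξ : ℝ}
    (hξ : ξ ∈ naturalParameters F) : IsProbabilityMeasure (law F ξ) := by
  have hi : Integrable (fun x : ℝ => Real.exp (ξ * x)) F := hξ
  have hpos : 0 < mgf id F ξ := mgf_pos' hF hi
  have hd : ∀ x, density F ξ x = Real.exp (ξ * x) / mgf id F ξ := by
    intro x
    rw [density, b, cgf, Real.exp_sub, Real.exp_log hpos]
  constructor
  rw [law, withDensity_apply _ MeasurableSet.univ, Measure.restrict_univ]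
  simp_rw [hd]
  rw [← ofReal_integral_eq_lintegral_ofReal (hi.div_const _)
    (Eventually.of_forall fun x => by positivity), integral_div]
  have : (∫ x, Real.exp (ξ * x) ∂F) = mgf id F ξ := rfl
  rw [this, div_self hpos.ne', ENNReal.ofReal_one]

/-- `P_ξ`: the probability measure on sequences `x = (X₁, X₂, …)` (with `X_{i+1} = x i`) under
which the coordinates are independent with common law `f_ξ dF`. -/
def seqLaw (F : Measure ℝ) (ξ : ℝ) : Measure (ℕ → ℝ) :=
  Measure.infinitePi fun _ : ℕ => law F ξ

/-- The Kullback–Leibler information number `I(lam, θ) = E_lam log (f_lam(X) / f_θ(X))`. -/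
def info (F : Measure ℝ) (lam θ : ℝ) : ℝ :=
  ∫ x, Real.log (density F lam x / density F θ x) ∂(law F lam)

/-- The stopping time `M(a)`: the least `n ≥ 1` such that
`∑_{i ≤ n} log (f_lam(X_i) / f_θ(X_i)) ≥ I(lam, θ) a` for all `θ ∈ [θ₀, θ₁]`,
and `⊤ = ∞` if there is no such `n`. -/
def M (F : Measure ℝ) (θ₀ θ₁ lam a : ℝ) (x : ℕ → ℝ) : ℕ∞ :=
  ⨅ (n : ℕ) (_ : 1 ≤ n ∧ ∀ θ ∈ Set.Icc θ₀ θ₁,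
    info F lam θ * a ≤
      ∑ i ∈ Finset.range n, Real.log (density F lam (x i) / density F θ (x i))), (n : ℕ∞)

/-- `P_ξ(M(a) < ∞)`. -/
def stopProb (F : Measure ℝ) (θ₀ θ₁ lam a ξ : ℝ) : ℝ :=
  (seqLaw F ξ).real {x | M F θ₀ θ₁ lam a x < ⊤}

/-- `E_ξ M(a)`, with values in `[0, ∞]`. -/
def expectedM (F : Measure ℝ) (θ₀ θ₁ lam a ξ : ℝ) : ℝ≥0∞ :=
  ∫⁻ x, (M F θ₀ θ₁ lam a x : ℝ≥0∞) ∂(seqLaw F ξ)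

/-- The constant
`C = ((lam - θ₁) / I(lam, θ₁) - (lam - θ₀) / I(lam, θ₀)) √(b''(lam) / (2π))`. -/
def C (F : Measure ℝ) (θ₀ θ₁ lam : ℝ) : ℝ :=
  ((lam - θ₁) / info F lam θ₁ - (lam - θ₀) / info F lam θ₀) *
    Real.sqrt (iteratedDeriv 2 (b F) lam / (2 * Real.pi))

end ExpFamily

end

/-! Let `S n` be the sum of the first `n` observations centred at `b'(lam)`, and let `g(θ) = (lam -
θ) / I(lam, θ)`. Since the log-likelihood sum equals `(lam - θ) S n + n I(lam, θ)`, the stopping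
condition at `θ` reads `n + g(θ) S n ≥ a`. Strict convexity of `b` makes `g` strictly increasing,
and the condition is affine in `g`, so only `θ₀` and `θ₁` matter. Hence `M(a)` is the first `n ≥ 1`
with `n ≥ a + h(S n)`, where `h(s) = max (-g(θ₀) s) (-g(θ₁) s)` is Lipschitz (`M_eq_passageTime`).

For such a time `T`, the excess of `T` over `a + h(S T)` is at most `1 + L |Y (T - 1)|`, where `Y`
are the centred observations. Wald's identities give `E T = O(a)`, then `E |T - a| = O(√a)`, and
with `n = ⌊a⌋` they bound `E (S T - S n)²` by `v E |T - n| = O(√a)`. So `E T = a + E h(S n) + O(a ^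
(1/4))` (`abs_expected_passageTime_sub_le`); fourth moments keep the excess within this error. The
central limit theorem with bounded second moments gives `E |S n| ∼ √(2 v n / π)`. The odd part of
`h` has mean zero, which leaves `(g(θ₁) - g(θ₀)) √(v a / (2π))`.

The probability bound is a change of measure: on `{M(a) = n}` the likelihood ratio of `θ` to `lam`
is at most `exp (-I(lam, θ) a)` by the stopping rule, and the events `{M(a) = n}` have total
`lam`-probability one (`stopProb_bounds`). -/

namespace FirstPassage

/-! ### First times and predictable transforms of independent variables. -/

/-- The first index at which a predicate holds, `⊤` if there is none. -/
noncomputable def firstTime (p : ℕ → Prop) : ℕ∞ := ⨅ (n : ℕ) (_ : p n), (n : ℕ∞)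

theorem lt_firstTime_iff {p : ℕ → Prop} {k : ℕ} :
    (k : ℕ∞) < firstTime p ↔ ∀ n ≤ k, ¬ p n := by
  rw [← ENat.add_one_le_iff (ENat.natCast_ne_top k), firstTime]
  simp only [le_iInf_iff]
  constructor
  · intro h n hn hp
    have := h n hp
    norm_cast at this
    omega
  · intro h n hp
    by_contra hlt
    push Not at hlt
    norm_cast at hlt
    exact h n (by omega) hp

theorem prop_of_firstTime_eq {p : ℕ → Prop} {n : ℕ} (h : firstTime p = n) : p n := by
  have h1 : ¬ ((n : ℕ∞) < firstTime p) := by rw [h]; exact lt_irrefl _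
  rw [lt_firstTime_iff] at h1
  push Not at h1
  obtain ⟨m, hm, hp⟩ := h1
  rcases hm.eq_or_lt with rfl | hlt
  · exact hp
  · have : (m : ℕ∞) < firstTime p := by rw [h]; exact_mod_cast hlt
    exact absurd hp (lt_firstTime_iff.1 this m le_rfl)

variable {Ω : Type*} {Y : ℕ → Ω → ℝ}

/-- The σ-algebra generated by `Y 0, …, Y (k - 1)`. -/
abbrev past (Y : ℕ → Ω → ℝ) (k : ℕ) : MeasurableSpace Ω :=
  ⨆ j ∈ Set.Iio k, MeasurableSpace.comap (Y j) inferInstance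

theorem past_mono {i k : ℕ} (h : i ≤ k) : past Y i ≤ past Y k :=
  biSup_mono fun _ hj => lt_of_lt_of_le hj h

theorem measurable_past {j k : ℕ} (h : j < k) : Measurable[past Y k] (Y j) :=
  Measurable.of_comap_le (le_iSup₂_of_le j h le_rfl)

variable [mΩ : MeasurableSpace Ω] {P : Measure Ω}

theorem past_le (hY : ∀ k, Measurable (Y k)) (k : ℕ) : past Y k ≤ mΩ :=
  iSup₂_le fun j _ => (hY j).comap_le

theorem indepFun_of_measurable_past (hY : ∀ k, Measurable (Y k)) (hind : iIndepFun Y P)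
    {k : ℕ} {G : Ω → ℝ} (hG : Measurable[past Y k] G) : IndepFun G (Y k) P := by
  have h := indep_iSup_of_disjoint (fun j => (hY j).comap_le) hind
    (S := Set.Iio k) (T := {k}) (by simp)
  rw [IndepFun_iff_Indep]
  refine indep_of_indep_of_le_left (indep_of_indep_of_le_right h ?_) hG.comap_le
  exact le_iSup₂_of_le k rfl le_rfl

theorem integral_mul_past [IsProbabilityMeasure P] (hY : ∀ k, Measurable (Y k))
    (hind : iIndepFun Y P) {k : ℕ} {G : Ω → ℝ} (hG : Measurable[past Y k] G) {f : ℝ → ℝ}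
    (hf : Measurable f) :
    ∫ ω, G ω * f (Y k ω) ∂P = (∫ ω, G ω ∂P) * ∫ ω, f (Y k ω) ∂P := by
  have h := (indepFun_of_measurable_past hY hind hG).comp measurable_id hf
  exact h.integral_fun_mul_eq_mul_integral
    (hG.mono (past_le hY k) le_rfl).aestronglyMeasurable
    (hf.comp (hY k)).aestronglyMeasurable

theorem integrable_mul_of_abs_le_one {c f : Ω → ℝ} (hc : Measurable c) (hc1 : ∀ ω, |c ω| ≤ 1)
    (hf : Integrable f P) : Integrable (fun ω => c ω * f ω) P :=
  hf.bdd_mul hc.aestronglyMeasurable (c := 1) (Eventually.of_forall hc1)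

/-- The `L²` isometry for martingale transforms of centred independent variables. -/
theorem integral_sq_transform [IsProbabilityMeasure P] (hY : ∀ k, Measurable (Y k))
    (hind : iIndepFun Y P) (h2 : ∀ k, MemLp (Y k) 2 P) (hmean : ∀ k, ∫ ω, Y k ω ∂P = 0)
    {v : ℝ} (hv : ∀ k, ∫ ω, Y k ω ^ 2 ∂P = v) {c : ℕ → Ω → ℝ}
    (hc : ∀ k, Measurable[past Y k] (c k)) (hc1 : ∀ k ω, |c k ω| ≤ 1) (N : ℕ) :
    MemLp (fun ω => ∑ k ∈ Finset.range N, c k ω * Y k ω) 2 P ∧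
      ∫ ω, (∑ k ∈ Finset.range N, c k ω * Y k ω) ^ 2 ∂P =
        v * ∫ ω, ∑ k ∈ Finset.range N, c k ω ^ 2 ∂P := by
  have hcm : ∀ k, Measurable (c k) := fun k => (hc k).mono (past_le hY k) le_rfl
  have hcY : ∀ k, MemLp (fun ω => c k ω * Y k ω) 2 P := fun k =>
    (h2 k).mono ((hcm k).mul (hY k)).aestronglyMeasurable (Eventually.of_forall fun ω => by
      rw [norm_mul]
      exact mul_le_of_le_one_left (norm_nonneg _) (hc1 k ω))
  have hc2 : ∀ k, Integrable (fun ω => c k ω ^ 2) P := fun k =>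
    Integrable.of_bound ((hcm k).pow_const 2).aestronglyMeasurable 1
      (Eventually.of_forall fun ω => by
        rw [norm_pow]
        exact pow_le_one₀ (norm_nonneg _) (hc1 k ω))
  have hmem : ∀ N, MemLp (fun ω => ∑ k ∈ Finset.range N, c k ω * Y k ω) 2 P := fun N =>
    memLp_finsetSum _ fun k _ => hcY k
  refine ⟨hmem N, ?_⟩
  induction N with
  | zero => simp
  | succ N ih =>
    set Z : Ω → ℝ := fun ω => ∑ k ∈ Finset.range N, c k ω * Y k ω with hZ
    have hZm : Measurable[past Y N] Z := by
      refine Finset.measurable_fun_sum _ fun k hk => ?_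
      have hk' : k < N := Finset.mem_range.1 hk
      exact ((hc k).mono (past_mono hk'.le) le_rfl).mul (measurable_past hk')
    have e : ∀ ω, (∑ k ∈ Finset.range (N + 1), c k ω * Y k ω) ^ 2 =
        Z ω ^ 2 + 2 * (Z ω * c N ω * Y N ω) + c N ω ^ 2 * Y N ω ^ 2 := by
      intro ω
      rw [Finset.sum_range_succ]
      simp only [hZ]
      ring
    have i1 : Integrable (fun ω => Z ω ^ 2) P := (hmem N).integrable_sq
    have i2 : Integrable (fun ω => Z ω * c N ω * Y N ω) P := by
      have := (hmem N).integrable_mul (hcY N)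
      refine this.congr (Eventually.of_forall fun ω => ?_)
      simp only [hZ, Pi.mul_apply]
      ring
    have i3 : Integrable (fun ω => c N ω ^ 2 * Y N ω ^ 2) P := by
      refine (hcY N).integrable_sq.congr (Eventually.of_forall fun ω => ?_)
      simp only
      ring
    have i12 : Integrable (fun ω => Z ω ^ 2 + 2 * (Z ω * c N ω * Y N ω)) P :=
      i1.add (i2.const_mul 2)
    -- The cross term vanishes because `Z * c N` depends only on the past, hence is independent of
    -- the centred `Y N`.
    have z2 : ∫ ω, Z ω * c N ω * Y N ω ∂P = 0 := by
      have := integral_mul_past hY hind (hZm.mul (hc N)) (f := id) measurable_id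
      simp only [Pi.mul_apply, id] at this
      rw [this, hmean, mul_zero]
    have z3 : ∫ ω, c N ω ^ 2 * Y N ω ^ 2 ∂P = v * ∫ ω, c N ω ^ 2 ∂P := by
      rw [integral_mul_past hY hind ((hc N).pow_const 2) (f := fun y => y ^ 2) (by fun_prop), hv]
      ring
    simp_rw [e, Finset.sum_range_succ]
    rw [integral_add i12 i3, integral_add i1 (i2.const_mul 2),
      integral_const_mul, z2, z3, ih, integral_add (integrable_finsetSum _ fun k _ => hc2 k) (hc2 N)]
    ring

end FirstPassage

/-! ### Stopping times, Wald's identities and passage to the limit in the truncation. -/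

namespace FirstPassage

/-- `min T N` as a natural number. -/
noncomputable def trunc (T : ℕ∞) (N : ℕ) : ℕ := (min T N).toNat

theorem coe_trunc (T : ℕ∞) (N : ℕ) : (trunc T N : ℕ∞) = min T N :=
  ENat.natCast_toNat (ne_top_of_le_ne_top (ENat.natCast_ne_top N) (min_le_right _ _))

theorem lt_trunc_iff {T : ℕ∞} {N k : ℕ} : k < trunc T N ↔ (k : ℕ∞) < T ∧ k < N := by
  rw [← Nat.cast_lt (α := ℕ∞), coe_trunc, lt_min_iff, Nat.cast_lt]

theorem trunc_coe (t N : ℕ) : trunc (t : ℕ∞) N = min t N := by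
  rw [← Nat.cast_inj (R := ℕ∞), coe_trunc]
  rfl

/-- The indicator that `T` exceeds `k`. -/
noncomputable def alive (T : ℕ∞) (k : ℕ) : ℝ := open Classical in if (k : ℕ∞) < T then 1 else 0

theorem abs_alive_le_one (T : ℕ∞) (k : ℕ) : |alive T k| ≤ 1 := by
  unfold alive
  split_ifs <;> simp

/-- Writes a stopped sum as a transform over a deterministic range; for a stopping time the
coefficients are predictable, which is what Wald's identities need. -/
theorem sum_alive_mul (T : ℕ∞) (N : ℕ) (f : ℕ → ℝ) :
    ∑ k ∈ Finset.range N, alive T k * f k = ∑ k ∈ Finset.range (trunc T N), f k := by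
  classical
  have : Finset.range (trunc T N) = Finset.filter (fun k : ℕ => (k : ℕ∞) < T) (Finset.range N) := by
    ext k
    simp [lt_trunc_iff, and_comm]
  rw [this, Finset.sum_filter]
  refine Finset.sum_congr rfl fun k _ => ?_
  unfold alive
  split_ifs <;> simp

theorem sum_alive (T : ℕ∞) (N : ℕ) : ∑ k ∈ Finset.range N, alive T k = trunc T N := by
  simpa using sum_alive_mul T N fun _ => 1

/-- The differences take values in `{-1, 0, 1}` with a sign that does not depend on `k`, so squaring
them only fixes the sign. -/
theorem sum_sq_alive_sub (T : ℕ∞) {n N : ℕ} (h : n ≤ N) :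
    ∑ k ∈ Finset.range N, (alive T k - alive n k) ^ 2 = |(trunc T N : ℝ) - n| := by
  have hn : ∑ k ∈ Finset.range N, alive n k = n := by
    rw [sum_alive, trunc_coe, min_eq_left h]
  rw [← hn, ← sum_alive T N, ← Finset.sum_sub_distrib]
  rcases le_total T (n : ℕ∞) with hT | hT
  · have hs : ∀ k, (alive T k - alive n k) ^ 2 = -(alive T k - alive n k) := by
      intro k
      unfold alive
      by_cases h1 : (k : ℕ∞) < T
      · simp [h1, h1.trans_le hT]
      · split_ifs <;> simp
    rw [Finset.sum_congr rfl fun k _ => hs k, Finset.sum_neg_distrib, eq_comm, abs_of_nonpos]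
    rw [← neg_nonneg, ← Finset.sum_neg_distrib]
    exact Finset.sum_nonneg fun k _ => (hs k) ▸ sq_nonneg _
  · have hs : ∀ k, (alive T k - alive n k) ^ 2 = alive T k - alive n k := by
      intro k
      unfold alive
      by_cases h1 : (k : ℕ∞) < n
      · simp [h1, h1.trans_le hT]
      · split_ifs <;> simp
    rw [Finset.sum_congr rfl fun k _ => hs k, eq_comm, abs_of_nonneg]
    exact Finset.sum_nonneg fun k _ => (hs k) ▸ sq_nonneg _

variable {Ω : Type*} {Y : ℕ → Ω → ℝ}

/-- `T` is a stopping time: `{k < T}` depends on the first `k` observations. -/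
def IsStop (Y : ℕ → Ω → ℝ) (T : Ω → ℕ∞) : Prop :=
  ∀ k, MeasurableSet[past Y k] {ω | (k : ℕ∞) < T ω}

theorem IsStop.measurable_alive {T : Ω → ℕ∞} (hT : IsStop Y T) (k : ℕ) :
    Measurable[past Y k] fun ω => alive (T ω) k := by
  classical
  exact Measurable.ite (hT k) measurable_const measurable_const

variable [mΩ : MeasurableSpace Ω] {P : Measure Ω}

/-- Independent centred variables with common second moment `v` and fourth moment `m`. -/
structure CenteredWalk (P : Measure Ω) (Y : ℕ → Ω → ℝ) (v m : ℝ) : Prop where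
  meas : ∀ k, Measurable (Y k)
  indep : iIndepFun Y P
  ident : ∀ k, IdentDistrib (Y k) (Y 0) P P
  memLp : MemLp (Y 0) 2 P
  mean : ∫ ω, Y 0 ω ∂P = 0
  sq : ∫ ω, Y 0 ω ^ 2 ∂P = v
  integrable_four : Integrable (fun ω => Y 0 ω ^ 4) P
  four : ∫ ω, Y 0 ω ^ 4 ∂P = m

theorem IsStop.measurable_trunc (hY : ∀ k, Measurable (Y k)) {T : Ω → ℕ∞} (hT : IsStop Y T)
    (N : ℕ) : Measurable fun ω => (trunc (T ω) N : ℝ) := by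
  simp_rw [← sum_alive]
  exact Finset.measurable_fun_sum _ fun k _ =>
    (hT.measurable_alive k).mono (past_le hY k) le_rfl

theorem trunc_le (T : ℕ∞) (N : ℕ) : trunc T N ≤ N := by
  rw [← Nat.cast_le (α := ℕ∞), coe_trunc]
  exact min_le_right _ _

theorem IsStop.integrable_trunc [IsFiniteMeasure P] (hY : ∀ k, Measurable (Y k)) {T : Ω → ℕ∞}
    (hT : IsStop Y T) (N : ℕ) : Integrable (fun ω => (trunc (T ω) N : ℝ)) P :=
  Integrable.of_bound (hT.measurable_trunc hY N).aestronglyMeasurable N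
    (Eventually.of_forall fun ω => by simpa using trunc_le (T ω) N)

/-- Wald's first identity for the truncated stopping time. -/
theorem IsStop.wald [IsProbabilityMeasure P] (hY : ∀ k, Measurable (Y k)) (hind : iIndepFun Y P)
    {T : Ω → ℕ∞} (hT : IsStop Y T) {f : ℝ → ℝ} (hf : Measurable f) {m : ℝ}
    (hi : ∀ k, Integrable (fun ω => f (Y k ω)) P) (hm : ∀ k, ∫ ω, f (Y k ω) ∂P = m) (N : ℕ) :
    Integrable (fun ω => ∑ k ∈ Finset.range (trunc (T ω) N), f (Y k ω)) P ∧
      ∫ ω, ∑ k ∈ Finset.range (trunc (T ω) N), f (Y k ω) ∂P =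
        m * ∫ ω, (trunc (T ω) N : ℝ) ∂P := by
  have ha : ∀ k, Measurable fun ω => alive (T ω) k := fun k =>
    (hT.measurable_alive k).mono (past_le hY k) le_rfl
  have hint : ∀ k, Integrable (fun ω => alive (T ω) k * f (Y k ω)) P := fun k =>
    integrable_mul_of_abs_le_one (ha k) (fun ω => abs_alive_le_one _ _) (hi k)
  have hia : ∀ k, Integrable (fun ω => alive (T ω) k) P := fun k =>
    Integrable.of_bound (ha k).aestronglyMeasurable 1
      (Eventually.of_forall fun ω => abs_alive_le_one _ _)
  simp_rw [← sum_alive, ← fun ω => sum_alive_mul (T ω) N fun k => f (Y k ω)]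
  refine ⟨integrable_finsetSum _ fun k _ => hint k, ?_⟩
  rw [integral_finsetSum _ fun k _ => hint k, integral_finsetSum _ fun k _ => hia k,
    Finset.mul_sum]
  refine Finset.sum_congr rfl fun k _ => ?_
  rw [integral_mul_past hY hind (hT.measurable_alive k) hf, hm, mul_comm]

variable {v m : ℝ}

namespace CenteredWalk

theorem memLp' (h : CenteredWalk P Y v m) (k : ℕ) : MemLp (Y k) 2 P :=
  (h.ident k).memLp_iff.2 h.memLp

theorem mean' (h : CenteredWalk P Y v m) (k : ℕ) : ∫ ω, Y k ω ∂P = 0 := by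
  rw [(h.ident k).integral_eq, h.mean]

theorem sq' (h : CenteredWalk P Y v m) (k : ℕ) : ∫ ω, Y k ω ^ 2 ∂P = v := by
  have := ((h.ident k).comp (u := fun y : ℝ => y ^ 2) (by fun_prop)).integral_eq
  simpa [h.sq] using this

theorem integrable_four' (h : CenteredWalk P Y v m) (k : ℕ) :
    Integrable (fun ω => Y k ω ^ 4) P :=
  ((h.ident k).comp (u := fun y : ℝ => y ^ 4) (by fun_prop)).integrable_iff.2 h.integrable_four

theorem four' (h : CenteredWalk P Y v m) (k : ℕ) : ∫ ω, Y k ω ^ 4 ∂P = m := by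
  have := ((h.ident k).comp (u := fun y : ℝ => y ^ 4) (by fun_prop)).integral_eq
  simpa [h.four] using this

theorem sq_nonneg' (h : CenteredWalk P Y v m) : 0 ≤ v :=
  h.sq ▸ integral_nonneg fun _ => sq_nonneg _

theorem four_nonneg (h : CenteredWalk P Y v m) : 0 ≤ m :=
  h.four ▸ integral_nonneg fun _ => by positivity

variable [IsProbabilityMeasure P]

/-- Wald's second identity for the truncated stopping time, relative to a fixed time. -/
theorem integral_sq_sub (h : CenteredWalk P Y v m) {T : Ω → ℕ∞} (hT : IsStop Y T) {n N : ℕ}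
    (hn : n ≤ N) :
    Integrable (fun ω => (∑ k ∈ Finset.range (trunc (T ω) N), Y k ω
        - ∑ k ∈ Finset.range n, Y k ω) ^ 2) P ∧
      ∫ ω, (∑ k ∈ Finset.range (trunc (T ω) N), Y k ω - ∑ k ∈ Finset.range n, Y k ω) ^ 2 ∂P =
        v * ∫ ω, |(trunc (T ω) N : ℝ) - n| ∂P := by
  have key := integral_sq_transform h.meas h.indep h.memLp' h.mean' h.sq'
    (c := fun k ω => alive (T ω) k - alive n k)
    (fun k => (hT.measurable_alive k).sub_const _)
    (fun k ω => by
      simp only [alive]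
      split_ifs <;> simp) N
  have e : ∀ ω, ∑ k ∈ Finset.range N, (alive (T ω) k - alive n k) * Y k ω =
      ∑ k ∈ Finset.range (trunc (T ω) N), Y k ω - ∑ k ∈ Finset.range n, Y k ω := by
    intro ω
    simp_rw [sub_mul]
    rw [Finset.sum_sub_distrib, sum_alive_mul, sum_alive_mul, trunc_coe, min_eq_left hn]
  simp_rw [e, sum_sq_alive_sub _ hn] at key
  exact ⟨key.1.integrable_sq, key.2⟩

end CenteredWalk

/-- Fatou's lemma: a uniform bound on the truncated integrals replaces a dominating function. -/
theorem integrable_and_integral_le_of_eventually_eq {f : ℕ → Ω → ℝ} {g : Ω → ℝ} {B : ℝ}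
    (hB : 0 ≤ B)
    (hf : ∀ N, Integrable (f N) P) (h0 : ∀ N ω, 0 ≤ f N ω) (hle : ∀ N, ∫ ω, f N ω ∂P ≤ B)
    (hfg : ∀ᵐ ω ∂P, ∀ᶠ N in atTop, f N ω = g ω) :
    Integrable g P ∧ ∫ ω, g ω ∂P ≤ B := by
  have hlim : ∀ᵐ ω ∂P, Tendsto (fun N => f N ω) atTop (𝓝 (g ω)) :=
    hfg.mono fun ω h => tendsto_nhds_of_eventually_eq h
  have hg : AEStronglyMeasurable g P :=
    aestronglyMeasurable_of_tendsto_ae atTop (fun N => (hf N).aestronglyMeasurable) hlim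
  have hg0 : 0 ≤ᵐ[P] g := hlim.mono fun ω h => ge_of_tendsto' h fun N => h0 N ω
  have hl : ∫⁻ ω, ENNReal.ofReal (g ω) ∂P ≤ ENNReal.ofReal B := by
    calc ∫⁻ ω, ENNReal.ofReal (g ω) ∂P
        = ∫⁻ ω, liminf (fun N => ENNReal.ofReal (f N ω)) atTop ∂P :=
          lintegral_congr_ae (hlim.mono fun ω h =>
            ((ENNReal.continuous_ofReal.tendsto _).comp h).liminf_eq.symm)
      _ ≤ liminf (fun N => ∫⁻ ω, ENNReal.ofReal (f N ω) ∂P) atTop :=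
          lintegral_liminf_le' fun N => (hf N).aemeasurable.ennreal_ofReal
      _ ≤ ENNReal.ofReal B := by
          refine liminf_le_of_le (by isBoundedDefault) fun b hb => ?_
          obtain ⟨N, hN⟩ := hb.exists
          refine hN.trans ?_
          rw [← ofReal_integral_eq_lintegral_ofReal (hf N) (Eventually.of_forall (h0 N))]
          exact ENNReal.ofReal_le_ofReal (hle N)
  refine ⟨⟨hg, ?_⟩, ?_⟩
  · rw [hasFiniteIntegral_iff_ofReal hg0]
    exact hl.trans_lt ENNReal.ofReal_lt_top
  · rw [integral_eq_lintegral_of_nonneg_ae hg0 hg]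
    exact ENNReal.toReal_le_of_le_ofReal hB hl

theorem eventually_trunc_eq {T : ℕ∞} (hT : T < ⊤) : ∀ᶠ N in atTop, trunc T N = T.toNat := by
  lift T to ℕ using hT.ne
  filter_upwards [eventually_ge_atTop T] with N hN
  rw [trunc_coe, min_eq_left hN, ENat.toNat_natCast]

/-- The layer-cake formula, valid also for `T = ⊤`; measurability and the bound on the expectation
of `T` follow term by term. -/
theorem coe_eq_tsum_alive (T : ℕ∞) : (T : ℝ≥0∞) = ∑' k : ℕ, ENNReal.ofReal (alive T k) := by
  have hs : ∀ N, ∑ k ∈ Finset.range N, ENNReal.ofReal (alive T k) = (trunc T N : ℝ≥0∞) := by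
    intro N
    rw [← ENNReal.ofReal_sum_of_nonneg, sum_alive, ENNReal.ofReal_natCast]
    intro k _
    unfold alive
    split_ifs <;> simp
  refine tendsto_nhds_unique ?_ ENNReal.summable.hasSum.tendsto_sum_nat
  simp_rw [hs]
  rcases eq_or_ne T ⊤ with h | h
  · have : ∀ N, trunc T N = N := fun N => by simp [trunc, h]
    simp_rw [this, h]
    exact ENNReal.tendsto_nat_nhds_top
  · refine tendsto_nhds_of_eventually_eq ((eventually_trunc_eq (lt_top_iff_ne_top.2 h)).mono
      fun N hN => ?_)
    rw [hN]
    conv_rhs => rw [← ENat.natCast_toNat h]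
    simp

theorem IsStop.measurable_coe (hY : ∀ k, Measurable (Y k)) {T : Ω → ℕ∞} (hT : IsStop Y T) :
    Measurable fun ω => (T ω : ℝ≥0∞) := by
  simp_rw [coe_eq_tsum_alive]
  exact Measurable.tsum fun k =>
    ((hT.measurable_alive k).mono (past_le hY k) le_rfl).ennreal_ofReal

/-- A stopping time whose truncations have bounded expectation is integrable. -/
theorem IsStop.lintegral_le [IsProbabilityMeasure P] (hY : ∀ k, Measurable (Y k)) {T : Ω → ℕ∞}
    (hT : IsStop Y T) {B : ℝ} (hB : ∀ N, ∫ ω, (trunc (T ω) N : ℝ) ∂P ≤ B) :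
    ∫⁻ ω, (T ω : ℝ≥0∞) ∂P ≤ ENNReal.ofReal B := by
  have ha : ∀ k, Measurable fun ω => ENNReal.ofReal (alive (T ω) k) := fun k =>
    ((hT.measurable_alive k).mono (past_le hY k) le_rfl).ennreal_ofReal
  simp_rw [coe_eq_tsum_alive]
  rw [lintegral_tsum fun k => (ha k).aemeasurable]
  refine ENNReal.summable.tsum_le_of_sum_range_le fun N => ?_
  rw [← lintegral_finsetSum _ fun k _ => ha k]
  have : ∀ ω, ∑ k ∈ Finset.range N, ENNReal.ofReal (alive (T ω) k) =
        ENNReal.ofReal (trunc (T ω) N : ℝ) := by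
    intro ω
    rw [← ENNReal.ofReal_sum_of_nonneg, sum_alive]
    intro k _
    unfold alive
    split_ifs <;> simp
  simp_rw [this]
  rw [← ofReal_integral_eq_lintegral_ofReal (hT.integrable_trunc hY N)
    (Eventually.of_forall fun ω => by positivity)]
  exact ENNReal.ofReal_le_ofReal (hB N)

end FirstPassage

/-! ### Passage over a Lipschitz random boundary: `E T` up to `O(a ^ (1/4))`. -/

namespace FirstPassage

variable {Ω : Type*} {Y : ℕ → Ω → ℝ}

/-- The first time `n ≥ 1` at which `n` reaches the random curve `a + h (Y 0 + ⋯ + Y (n - 1))`. -/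
noncomputable def passageTime (h : ℝ → ℝ) (a : ℝ) (Y : ℕ → Ω → ℝ) (ω : Ω) : ℕ∞ :=
  firstTime fun n => 1 ≤ n ∧ a + h (∑ k ∈ Finset.range n, Y k ω) ≤ n

theorem isStop_passageTime {h : ℝ → ℝ} (hm : Measurable h) (a : ℝ) :
    IsStop Y (passageTime h a Y) := by
  intro k
  have : {ω | (k : ℕ∞) < passageTime h a Y ω} =
      ⋂ n ∈ Finset.range (k + 1), {ω | ¬ (1 ≤ n ∧ a + h (∑ j ∈ Finset.range n, Y j ω) ≤ n)} := by
    ext ω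
    simp [passageTime, lt_firstTime_iff]
  rw [this]
  refine Finset.measurableSet_biInter _ fun n hn => ?_
  have hS : Measurable[past Y k] fun ω => ∑ j ∈ Finset.range n, Y j ω :=
    Finset.measurable_fun_sum _ fun j hj => measurable_past
      (lt_of_lt_of_le (Finset.mem_range.1 hj) (Nat.lt_succ_iff.1 (Finset.mem_range.1 hn)))
  refine MeasurableSet.compl ?_
  by_cases h1 : 1 ≤ n
  · simp only [h1, true_and]
    exact measurableSet_le ((hm.comp hS).const_add a) measurable_const
  · simp only [h1, false_and]
    exact @MeasurableSet.empty _ (past Y k)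

theorem mul_abs_le_sq {L δ : ℝ} (hδ : 0 < δ) (s : ℝ) :
    L * |s| ≤ δ * s ^ 2 + L ^ 2 / (4 * δ) := by
  have h1 : 0 ≤ (2 * δ * |s| - L) ^ 2 / (4 * δ) := by positivity
  have h2 : (2 * δ * |s| - L) ^ 2 / (4 * δ) = δ * s ^ 2 + L ^ 2 / (4 * δ) - L * |s| := by
    rw [← sq_abs s]
    field_simp
    ring
  linarith

theorem abs_le_add_sq_div {q : ℝ} (hq : 0 < q) (s : ℝ) : |s| ≤ q + s ^ 2 / q := by
  rw [← sq_abs s]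
  rcases le_total |s| q with h | h
  · have : 0 ≤ |s| ^ 2 / q := by positivity
    linarith
  · have : |s| ≤ |s| ^ 2 / q := by
      rw [le_div_iff₀ hq, sq]
      exact mul_le_mul_of_nonneg_left h (abs_nonneg _)
    linarith

/-- Used for the last increment with `q = a ^ (1/4)`: a sum of `O(q ^ 4)` fourth powers divided by
`q ^ 3` has mean `O(q)`. -/
theorem abs_le_add_four_div {q : ℝ} (hq : 0 < q) (s : ℝ) : |s| ≤ q + s ^ 4 / q ^ 3 := by
  have hs : s ^ 4 = |s| ^ 4 := by rw [← abs_pow, abs_of_nonneg (by positivity)]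
  rw [hs]
  rcases le_total |s| q with h | h
  · have : 0 ≤ |s| ^ 4 / q ^ 3 := by positivity
    linarith
  · have : |s| ≤ |s| ^ 4 / q ^ 3 := by
      rw [le_div_iff₀ (by positivity)]
      calc |s| * q ^ 3 ≤ |s| * |s| ^ 3 := by gcongr
        _ = |s| ^ 4 := by ring
    linarith

section Pointwise

variable {h : ℝ → ℝ} {L a : ℝ} {ω : Ω}

theorem lt_of_lt_passageTime (h0 : h 0 = 0) (ha : 0 < a) {j : ℕ}
    (hj : (j : ℕ∞) < passageTime h a Y ω) : (j : ℝ) < a + h (∑ k ∈ Finset.range j, Y k ω) := by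
  rcases Nat.eq_zero_or_pos j with rfl | hpos
  · simpa [h0] using ha
  · have := lt_firstTime_iff.1 hj j le_rfl
    by_contra hc
    exact this ⟨hpos, not_lt.1 hc⟩

/-- One step before the truncated time the walk is still under the boundary. The last increment is
dominated by the whole sum of squares, so that Wald's identities apply to both quadratic terms. -/
theorem trunc_passageTime_le (h0 : h 0 = 0) (hL : ∀ s t, |h s - h t| ≤ L * |s - t|)
    (hL0 : 0 ≤ L) (ha : 0 < a) {δ : ℝ} (hδ : 0 < δ) (N : ℕ) :
    (trunc (passageTime h a Y ω) N : ℝ) ≤ a + 1 +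
      δ * (∑ k ∈ Finset.range (trunc (passageTime h a Y ω) N), Y k ω) ^ 2 +
      δ * (∑ k ∈ Finset.range (trunc (passageTime h a Y ω) N), Y k ω ^ 2) + L ^ 2 / (2 * δ) := by
  have hT : ∀ j < trunc (passageTime h a Y ω) N, (j : ℕ∞) < passageTime h a Y ω :=
    fun j hj => (lt_trunc_iff.1 hj).1
  generalize trunc (passageTime h a Y ω) N = t at hT ⊢
  cases t with
  | zero =>
    have : 0 ≤ L ^ 2 / (2 * δ) := by positivity
    simp
    linarith
  | succ j =>
    have h1 := lt_of_lt_passageTime h0 ha (hT j j.lt_succ_self)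
    have h2 := (le_abs_self _).trans (hL (∑ k ∈ Finset.range j, Y k ω) 0)
    rw [h0, sub_zero, sub_zero] at h2
    have h3 : |∑ k ∈ Finset.range j, Y k ω| ≤ |∑ k ∈ Finset.range (j + 1), Y k ω| + |Y j ω| := by
      have : ∑ k ∈ Finset.range j, Y k ω = ∑ k ∈ Finset.range (j + 1), Y k ω - Y j ω := by
        rw [Finset.sum_range_succ]
        ring
      rw [this]
      exact abs_sub _ _
    have h4 := mul_le_mul_of_nonneg_left h3 hL0
    have h5 := mul_abs_le_sq (L := L) hδ (∑ k ∈ Finset.range (j + 1), Y k ω)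
    have h6 := mul_abs_le_sq (L := L) hδ (Y j ω)
    have h7 : Y j ω ^ 2 ≤ ∑ k ∈ Finset.range (j + 1), Y k ω ^ 2 :=
      Finset.single_le_sum (f := fun k => Y k ω ^ 2) (fun _ _ => sq_nonneg _)
        (Finset.self_mem_range_succ j)
    have h8 := mul_le_mul_of_nonneg_left h7 hδ.le
    have h9 : L ^ 2 / (2 * δ) = L ^ 2 / (4 * δ) + L ^ 2 / (4 * δ) := by
      field_simp
      ring
    push_cast
    rw [h9]
    linarith

theorem abs_passageTime_sub_le (h0 : h 0 = 0) (hL : ∀ s t, |h s - h t| ≤ L * |s - t|)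
    (hL0 : 0 ≤ L) (ha : 0 < a) {q : ℝ} (hq : 0 < q) (hT : passageTime h a Y ω < ⊤) :
    |((passageTime h a Y ω).toNat : ℝ) - a -
        h (∑ k ∈ Finset.range (passageTime h a Y ω).toNat, Y k ω)| ≤
      1 + L * (q + (∑ k ∈ Finset.range (passageTime h a Y ω).toNat, Y k ω ^ 4) / q ^ 3) := by
  obtain ⟨t, ht⟩ := ENat.ne_top_iff_exists.1 hT.ne
  have hp := prop_of_firstTime_eq (p := fun n => 1 ≤ n ∧ a + h (∑ k ∈ Finset.range n, Y k ω) ≤ n)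
    ht.symm
  have hlt : ∀ j < t, (j : ℕ∞) < passageTime h a Y ω := fun j hj => by
    rw [← ht]
    exact_mod_cast hj
  rw [← ht, ENat.toNat_natCast]
  obtain ⟨h1, hp⟩ := hp
  obtain ⟨j, rfl⟩ := Nat.exists_eq_succ_of_ne_zero (Nat.one_le_iff_ne_zero.1 h1)
  have h2 := lt_of_lt_passageTime h0 ha (hlt j j.lt_succ_self)
  have h3 := (le_abs_self _).trans (hL (∑ k ∈ Finset.range j, Y k ω)
    (∑ k ∈ Finset.range (j + 1), Y k ω))
  have h4 : |∑ k ∈ Finset.range j, Y k ω - ∑ k ∈ Finset.range (j + 1), Y k ω| = |Y j ω| := by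
    rw [Finset.sum_range_succ, ← abs_neg]
    congr 1
    ring
  rw [h4] at h3
  have h5 : Y j ω ^ 4 ≤ ∑ k ∈ Finset.range (j + 1), Y k ω ^ 4 :=
    Finset.single_le_sum (f := fun k => Y k ω ^ 4) (fun _ _ => by positivity)
      (Finset.self_mem_range_succ j)
  have h6 : |Y j ω| ≤ q + (∑ k ∈ Finset.range (j + 1), Y k ω ^ 4) / q ^ 3 :=
    (abs_le_add_four_div hq _).trans (by gcongr)
  have h7 := mul_le_mul_of_nonneg_left h6 hL0
  simp only [Nat.succ_eq_add_one] at *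
  push_cast at *
  rw [abs_of_nonneg (by linarith)]
  linarith

end Pointwise

variable [mΩ : MeasurableSpace Ω] {P : Measure Ω} [IsProbabilityMeasure P] {v m : ℝ}
  {h : ℝ → ℝ} {L : ℝ}

/-- A self-bounding argument: both quadratic terms of `trunc_passageTime_le` have mean `δ v` times
the expected truncated time, so a small `δ` lets them be absorbed on the left. -/
theorem CenteredWalk.integral_trunc_le (hw : CenteredWalk P Y v m) (hv : 0 < v)
    (hm : Measurable h) (h0 : h 0 = 0) (hL : ∀ s t, |h s - h t| ≤ L * |s - t|) (hL0 : 0 ≤ L)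
    {a : ℝ} (ha : 0 < a) (N : ℕ) :
    ∫ ω, (trunc (passageTime h a Y ω) N : ℝ) ∂P ≤ 2 * a + (2 + 4 * L ^ 2 * v) := by
  have hT := isStop_passageTime (Y := Y) hm a
  -- With `δ = 1 / (4 v)` each quadratic term contributes a quarter of the unknown expectation, and
  -- half of it remains on the left.
  have hδ : 0 < 1 / (4 * v) := by positivity
  have i0 := hT.integrable_trunc (P := P) hw.meas N
  have i1 := hw.integral_sq_sub hT (Nat.zero_le N)
  have i2 := hT.wald hw.meas hw.indep (f := fun y => y ^ 2) (by fun_prop)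
    (fun k => (hw.memLp' k).integrable_sq) hw.sq' N
  simp only [Finset.range_zero, Finset.sum_empty, sub_zero, Nat.cast_zero, Nat.abs_cast] at i1
  have hmono : ∫ ω, (trunc (passageTime h a Y ω) N : ℝ) ∂P ≤ ∫ ω, (a + 1 +
      1 / (4 * v) * (∑ k ∈ Finset.range (trunc (passageTime h a Y ω) N), Y k ω) ^ 2 +
      1 / (4 * v) * (∑ k ∈ Finset.range (trunc (passageTime h a Y ω) N), Y k ω ^ 2) +
        L ^ 2 / (2 * (1 / (4 * v)))) ∂P :=
    integral_mono i0 ((((integrable_const _).add (i1.1.const_mul _)).add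
      (i2.1.const_mul _)).add (integrable_const _))
      fun ω => trunc_passageTime_le h0 hL hL0 ha hδ N
  have j1 := (integrable_const (μ := P) (a + 1)).add (i1.1.const_mul (1 / (4 * v)))
  have j2 := j1.add (i2.1.const_mul (1 / (4 * v)))
  simp only [Pi.add_def] at j1 j2
  rw [integral_add j2 (integrable_const _), integral_add j1 (i2.1.const_mul _),
    integral_add (integrable_const _) (i1.1.const_mul _), integral_const_mul, integral_const_mul,
    i1.2, i2.2] at hmono
  simp only [integral_const, probReal_univ, one_smul] at hmono
  set x := ∫ ω, (trunc (passageTime h a Y ω) N : ℝ) ∂P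
  have e1 : 1 / (4 * v) * (v * x) = x / 4 := by field_simp
  have e2 : L ^ 2 / (2 * (1 / (4 * v))) = 2 * L ^ 2 * v := by field_simp; ring
  rw [e1, e2] at hmono
  linarith

theorem CenteredWalk.lintegral_passageTime_le (hw : CenteredWalk P Y v m) (hv : 0 < v)
    (hm : Measurable h) (h0 : h 0 = 0) (hL : ∀ s t, |h s - h t| ≤ L * |s - t|) (hL0 : 0 ≤ L)
    {a : ℝ} (ha : 0 < a) :
    ∫⁻ ω, (passageTime h a Y ω : ℝ≥0∞) ∂P ≤ ENNReal.ofReal (2 * a + (2 + 4 * L ^ 2 * v)) :=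
  (isStop_passageTime hm a).lintegral_le hw.meas
    (hw.integral_trunc_le hv hm h0 hL hL0 ha)

omit [IsProbabilityMeasure P] in
theorem IsStop.ae_lt_top (hY : ∀ k, Measurable (Y k)) {T : Ω → ℕ∞} (hT : IsStop Y T)
    (hfin : ∫⁻ ω, (T ω : ℝ≥0∞) ∂P ≠ ⊤) : ∀ᵐ ω ∂P, T ω < ⊤ := by
  filter_upwards [MeasureTheory.ae_lt_top (hT.measurable_coe hY) hfin] with ω hω
  simpa using hω

/-- The moments of a centred walk stopped at an integrable stopping time. -/
theorem CenteredWalk.stopped_moments (hw : CenteredWalk P Y v m) {T : Ω → ℕ∞} (hT : IsStop Y T)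
    {B : ℝ} (hB : ∀ N, ∫ ω, (trunc (T ω) N : ℝ) ∂P ≤ B) (hfin : ∀ᵐ ω ∂P, T ω < ⊤) :
    (Integrable (fun ω => ((T ω).toNat : ℝ)) P ∧ ∫ ω, ((T ω).toNat : ℝ) ∂P ≤ B) ∧
    (∀ n : ℕ, Integrable (fun ω => (∑ k ∈ Finset.range (T ω).toNat, Y k ω
          - ∑ k ∈ Finset.range n, Y k ω) ^ 2) P ∧
        ∫ ω, (∑ k ∈ Finset.range (T ω).toNat, Y k ω - ∑ k ∈ Finset.range n, Y k ω) ^ 2 ∂P ≤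
          v * ∫ ω, |((T ω).toNat : ℝ) - n| ∂P) ∧
    (Integrable (fun ω => ∑ k ∈ Finset.range (T ω).toNat, Y k ω ^ 4) P ∧
      ∫ ω, ∑ k ∈ Finset.range (T ω).toNat, Y k ω ^ 4 ∂P ≤ m * B) := by
  have hev : ∀ᵐ ω ∂P, ∀ᶠ N in atTop, trunc (T ω) N = (T ω).toNat :=
    hfin.mono fun ω hω => eventually_trunc_eq hω
  have hB0 : 0 ≤ B := (integral_nonneg fun ω => by positivity).trans (hB 0)
  have hit : Integrable (fun ω => ((T ω).toNat : ℝ)) P ∧ ∫ ω, ((T ω).toNat : ℝ) ∂P ≤ B := by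
    refine integrable_and_integral_le_of_eventually_eq hB0
      (fun N => hT.integrable_trunc hw.meas N) (fun N ω => by positivity) hB ?_
    filter_upwards [hev] with ω hω
    filter_upwards [hω] with N hN
    rw [hN]
  refine ⟨hit, fun n => ?_, ?_⟩
  · refine integrable_and_integral_le_of_eventually_eq
      -- Truncating at `N + n` guarantees that the truncation level is at least `n`, as
      -- `integral_sq_sub` requires.
      (f := fun N ω => (∑ k ∈ Finset.range (trunc (T ω) (N + n)), Y k ω
          - ∑ k ∈ Finset.range n, Y k ω) ^ 2)
      (mul_nonneg hw.sq_nonneg' (integral_nonneg fun ω => abs_nonneg _))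
      (fun N => (hw.integral_sq_sub hT (Nat.le_add_left n N)).1) (fun N ω => sq_nonneg _)
      (fun N => ?_) ?_
    · rw [(hw.integral_sq_sub hT (Nat.le_add_left n N)).2]
      refine mul_le_mul_of_nonneg_left (integral_mono_ae
        ((hT.integrable_trunc hw.meas _).sub (integrable_const _)).abs
        (hit.1.sub (integrable_const _)).abs ?_) hw.sq_nonneg'
      filter_upwards [hfin] with ω hω
      obtain ⟨t, ht⟩ := ENat.ne_top_iff_exists.1 hω.ne
      simp only [← ht, trunc_coe, ENat.toNat_natCast]
      rcases le_total t (N + n) with h1 | h1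
      · rw [min_eq_left h1]
      · rw [min_eq_right h1]
        have h2 : ((N + n : ℕ) : ℝ) ≤ t := by exact_mod_cast h1
        have h3 : (n : ℝ) ≤ ((N + n : ℕ) : ℝ) := by exact_mod_cast Nat.le_add_left n N
        rw [abs_of_nonneg (by linarith), abs_of_nonneg (by linarith)]
        linarith
    · filter_upwards [hev] with ω hω
      filter_upwards [(tendsto_add_atTop_nat n).eventually hω] with N hN
      rw [hN]
  · have hwald := fun N => hT.wald hw.meas hw.indep (f := fun y => y ^ 4) (by fun_prop)
      hw.integrable_four' hw.four' N
    refine integrable_and_integral_le_of_eventually_eq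
      (f := fun N ω => ∑ k ∈ Finset.range (trunc (T ω) N), Y k ω ^ 4)
      (mul_nonneg hw.four_nonneg hB0) (fun N => (hwald N).1)
      (fun N ω => Finset.sum_nonneg fun _ _ => by positivity) (fun N => ?_) ?_
    · rw [(hwald N).2]
      exact mul_le_mul_of_nonneg_left (hB N) hw.four_nonneg
    · filter_upwards [hev] with ω hω
      filter_upwards [hω] with N hN
      rw [hN]

omit [IsProbabilityMeasure P] in
theorem CenteredWalk.memLp_sum (hw : CenteredWalk P Y v m) (n : ℕ) :
    MemLp (fun ω => ∑ k ∈ Finset.range n, Y k ω) 2 P :=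
  memLp_finsetSum _ fun k _ => hw.memLp' k

theorem CenteredWalk.integrable_comp_sum (hw : CenteredWalk P Y v m) (hm : Measurable h)
    (h0 : h 0 = 0) (hL : ∀ s t, |h s - h t| ≤ L * |s - t|) (n : ℕ) :
    Integrable (fun ω => h (∑ k ∈ Finset.range n, Y k ω)) P := by
  refine (((hw.memLp_sum n).integrable one_le_two).norm.const_mul L).mono'
    (hm.comp (Finset.measurable_fun_sum _ fun k _ => hw.meas k)).aestronglyMeasurable
    (Eventually.of_forall fun ω => ?_)
  simpa [h0] using hL (∑ k ∈ Finset.range n, Y k ω) 0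

/-- The expected passage time agrees with `a + E h(S_⌊a⌋)` up to `O(a ^ (1/4))`. -/
theorem CenteredWalk.abs_expected_passageTime_sub_le (hw : CenteredWalk P Y v m) (hv : 0 < v)
    (hm : Measurable h) (h0 : h 0 = 0) (hL : ∀ s t, |h s - h t| ≤ L * |s - t|) (hL0 : 0 ≤ L) :
    ∃ D : ℝ, ∀ q : ℝ, 1 ≤ q →
      |(∫⁻ ω, (passageTime h (q ^ 4) Y ω : ℝ≥0∞) ∂P).toReal - q ^ 4 -
        ∫ ω, h (∑ k ∈ Finset.range ⌊q ^ 4⌋₊, Y k ω) ∂P| ≤ D * q := by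
  -- Here `q = a ^ (1/4)`. `K` will bound `E T / q ^ 4` and `D₁` will bound `E |T - n| / q ^ 2`;
  -- neither depends on `q`.
  set K : ℝ := 2 + (2 + 4 * L ^ 2 * v) with hK
  set D₁ : ℝ := L * (v * K + 1) + 2 + L * (1 + m * K) with hD₁
  refine ⟨1 + L * (1 + m * K) + L * (1 + v * D₁), fun q hq => ?_⟩
  have hq0 : 0 < q := by linarith
  have ha : 0 < q ^ 4 := by positivity
  set T := passageTime h (q ^ 4) Y with hTdef
  have hT : IsStop Y T := isStop_passageTime hm _
  have hm0 := hw.four_nonneg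
  have hK0 : 0 ≤ K := by positivity
  have hD₁0 : 0 ≤ D₁ := by positivity
  have hB : ∀ N, ∫ ω, (trunc (T ω) N : ℝ) ∂P ≤ K * q ^ 4 := fun N => by
    refine (hw.integral_trunc_le hv hm h0 hL hL0 ha N).trans ?_
    have : 1 ≤ q ^ 4 := one_le_pow₀ hq
    have : 2 + 4 * L ^ 2 * v ≤ (2 + 4 * L ^ 2 * v) * q ^ 4 :=
      le_mul_of_one_le_right (by positivity) this
    rw [hK]
    linarith
  have hfin : ∀ᵐ ω ∂P, T ω < ⊤ := hT.ae_lt_top hw.meas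
    (ne_top_of_le_ne_top ENNReal.ofReal_ne_top (hw.lintegral_passageTime_le hv hm h0 hL hL0 ha))
  obtain ⟨⟨it, ht⟩, hS, iQ, hQ⟩ := hw.stopped_moments hT hB hfin
  set n := ⌊q ^ 4⌋₊ with hn
  set t : Ω → ℝ := fun ω => ((T ω).toNat : ℝ) with htdef
  set Q : Ω → ℝ := fun ω => ∑ k ∈ Finset.range (T ω).toNat, Y k ω ^ 4 with hQdef
  set S : Ω → ℝ := fun ω => ∑ k ∈ Finset.range (T ω).toNat, Y k ω with hSdef
  set S' : Ω → ℝ := fun ω => ∑ k ∈ Finset.range n, Y k ω with hS'def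
  have iS : Integrable (fun ω => S ω ^ 2) P := by simpa using (hS 0).1
  have eS : ∫ ω, S ω ^ 2 ∂P ≤ v * (K * q ^ 4) := by
    refine (by simpa using (hS 0).2 : ∫ ω, S ω ^ 2 ∂P ≤ v * ∫ ω, t ω ∂P).trans ?_
    gcongr
  have hpt : ∀ᵐ ω ∂P, |t ω - q ^ 4 - h (S ω)| ≤ 1 + L * (q + Q ω / q ^ 3) := by
    filter_upwards [hfin] with ω hω
    exact abs_passageTime_sub_le h0 hL hL0 ha hq0 hω
  have iQ' : Integrable (fun ω => L * (q + Q ω / q ^ 3)) P :=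
    ((integrable_const q).add (iQ.div_const _)).const_mul L
  have eQ' : ∫ ω, L * (q + Q ω / q ^ 3) ∂P ≤ L * (1 + m * K) * q := by
    rw [integral_const_mul, integral_add (integrable_const q) (iQ.div_const _), integral_div,
      integral_const, probReal_univ, one_smul, mul_assoc]
    gcongr
    have : (∫ ω, Q ω ∂P) / q ^ 3 ≤ m * (K * q ^ 4) / q ^ 3 := by gcongr
    have e : m * (K * q ^ 4) / q ^ 3 = m * K * q := by field_simp
    linarith
  -- The stopped sum has second moment `O(q ^ 4)`, so `q ^ 2` is the scale at which
  -- `abs_le_add_sq_div` loses only a constant.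
  have iS2 : Integrable (fun ω => L * (q ^ 2 + S ω ^ 2 / q ^ 2)) P :=
    ((integrable_const (q ^ 2)).add (iS.div_const _)).const_mul L
  have eS2 : ∫ ω, L * (q ^ 2 + S ω ^ 2 / q ^ 2) ∂P ≤ L * (v * K + 1) * q ^ 2 := by
    rw [integral_const_mul, integral_add (integrable_const _) (iS.div_const _), integral_div,
      integral_const, probReal_univ, one_smul, mul_assoc]
    gcongr
    have : (∫ ω, S ω ^ 2 ∂P) / q ^ 2 ≤ v * (K * q ^ 4) / q ^ 2 := by gcongr
    have e : v * (K * q ^ 4) / q ^ 2 = v * K * q ^ 2 := by field_simp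
    linarith
  have etn : ∫ ω, |t ω - n| ∂P ≤ D₁ * q ^ 2 := by
    have hle : ∫ ω, |t ω - n| ∂P ≤
        ∫ ω, ((L * (q ^ 2 + S ω ^ 2 / q ^ 2) + 2) + L * (q + Q ω / q ^ 3)) ∂P := by
      refine integral_mono_ae (it.sub (integrable_const _)).abs
        ((iS2.add (integrable_const _)).add iQ') ?_
      filter_upwards [hpt] with ω hω
      have h1 : |h (S ω)| ≤ L * (q ^ 2 + S ω ^ 2 / q ^ 2) := by
        have := hL (S ω) 0
        rw [h0, sub_zero, sub_zero] at this
        exact this.trans (mul_le_mul_of_nonneg_left (abs_le_add_sq_div (by positivity) _) hL0)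
      have h2 : |q ^ 4 - n| ≤ 1 := by
        rw [abs_le]
        constructor
        · linarith [Nat.floor_le ha.le]
        · linarith [Nat.lt_floor_add_one (q ^ 4)]
      have h3 : t ω - n = (t ω - q ^ 4 - h (S ω)) + h (S ω) + (q ^ 4 - n) := by ring
      have h4 := abs_add_three (t ω - q ^ 4 - h (S ω)) (h (S ω)) (q ^ 4 - n)
      rw [← h3] at h4
      linarith
    have j1 : Integrable (fun ω => L * (q ^ 2 + S ω ^ 2 / q ^ 2) + 2) P :=
      iS2.add (integrable_const _)
    rw [integral_add j1 iQ', integral_add iS2 (integrable_const _), integral_const,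
      probReal_univ, one_smul] at hle
    have h5 : q ≤ q ^ 2 := by nlinarith
    have h6 : L * (1 + m * K) * q ≤ L * (1 + m * K) * q ^ 2 := by gcongr
    have h7 : (2 : ℝ) ≤ 2 * q ^ 2 := by nlinarith
    rw [hD₁]
    linarith
  obtain ⟨iD, eD⟩ := hS n
  have eD' : ∫ ω, (S ω - S' ω) ^ 2 ∂P ≤ v * (D₁ * q ^ 2) := eD.trans (by gcongr)
  -- The second moment of `S - S'` is only `O(q ^ 2)`, so the balancing scale is now `q`; this is
  -- the gain from comparing with the fixed time `n`.
  have iD2 : Integrable (fun ω => L * (q + (S ω - S' ω) ^ 2 / q)) P :=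
    ((integrable_const q).add (iD.div_const _)).const_mul L
  have eD2 : ∫ ω, L * (q + (S ω - S' ω) ^ 2 / q) ∂P ≤ L * (1 + v * D₁) * q := by
    rw [integral_const_mul, integral_add (integrable_const _) (iD.div_const _), integral_div,
      integral_const, probReal_univ, one_smul, mul_assoc]
    gcongr
    have : (∫ ω, (S ω - S' ω) ^ 2 ∂P) / q ≤ v * (D₁ * q ^ 2) / q := by gcongr
    have e : v * (D₁ * q ^ 2) / q = v * D₁ * q := by field_simp
    linarith
  have et : (∫⁻ ω, (T ω : ℝ≥0∞) ∂P).toReal = ∫ ω, t ω ∂P := by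
    rw [integral_eq_lintegral_of_nonneg_ae (Eventually.of_forall fun ω => by positivity)
      it.aestronglyMeasurable]
    congr 1
    refine lintegral_congr_ae ?_
    filter_upwards [hfin] with ω hω
    conv_lhs => rw [← ENat.natCast_toNat hω.ne]
    simp [htdef]
  have ihS : Integrable (fun ω => h (S' ω)) P := hw.integrable_comp_sum hm h0 hL n
  have itot : ∫ ω, (t ω - q ^ 4 - h (S' ω)) ∂P =
      ∫ ω, t ω ∂P - q ^ 4 - ∫ ω, h (S' ω) ∂P := by
    have j0 : Integrable (fun ω => t ω - q ^ 4) P := it.sub (integrable_const _)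
    rw [integral_sub j0 ihS, integral_sub it (integrable_const _)]
    simp
  rw [et, ← itot]
  have hle : ∫ ω, |t ω - q ^ 4 - h (S' ω)| ∂P ≤
      ∫ ω, ((1 + L * (q + Q ω / q ^ 3)) + L * (q + (S ω - S' ω) ^ 2 / q)) ∂P := by
    refine integral_mono_ae ((it.sub (integrable_const _)).sub ihS).abs
      (((integrable_const 1).add iQ').add iD2) ?_
    filter_upwards [hpt] with ω hω
    have h1 : |h (S ω) - h (S' ω)| ≤ L * (q + (S ω - S' ω) ^ 2 / q) :=
      (hL _ _).trans (mul_le_mul_of_nonneg_left (abs_le_add_sq_div hq0 _) hL0)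
    have h2 := abs_add_le (t ω - q ^ 4 - h (S ω)) (h (S ω) - h (S' ω))
    rw [sub_add_sub_cancel] at h2
    linarith
  have j1 : Integrable (fun ω => 1 + L * (q + Q ω / q ^ 3)) P := (integrable_const 1).add iQ'
  rw [integral_add j1 iD2, integral_add (integrable_const _) iQ', integral_const,
      probReal_univ, one_smul] at hle
  refine (abs_integral_le_integral_abs).trans ?_
  linarith

end FirstPassage

/-! ### Gaussian limit of the absolute moment, and the wedge-shaped boundary. -/

namespace FirstPassage

theorem integral_abs_gaussianReal {v : NNReal} (hv : v ≠ 0) :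
    ∫ x, |x| ∂(gaussianReal 0 v) = √(2 * v / Real.pi) := by
  have hv' : (0 : ℝ) < v := by positivity
  rw [integral_gaussianReal_eq_integral_smul hv]
  have e : ∀ x : ℝ, gaussianPDFReal 0 v x • |x| = (√(2 * Real.pi * v))⁻¹ *
      (|x| ^ (1 : ℝ) * Real.exp (-(1 / (2 * v)) * |x| ^ (2 : ℝ))) := by
    intro x
    rw [gaussianPDFReal, smul_eq_mul, Real.rpow_one, Real.rpow_two, sq_abs, sub_zero,
      show -(1 / (2 * (v : ℝ))) * x ^ 2 = -x ^ 2 / (2 * v) by ring]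
    ring
  simp_rw [e]
  rw [integral_const_mul, integral_comp_abs
    (f := fun x : ℝ => x ^ (1 : ℝ) * Real.exp (-(1 / (2 * (v : ℝ))) * x ^ (2 : ℝ))),
    integral_rpow_mul_exp_neg_mul_rpow (by norm_num) (by norm_num) (by positivity)]
  rw [show -((1 : ℝ) + 1) / 2 = -1 by norm_num, show ((1 : ℝ) + 1) / 2 = 1 by norm_num,
    Real.Gamma_one, Real.rpow_neg_one, eq_comm, Real.sqrt_eq_iff_eq_sq (by positivity)
    (by positivity), mul_pow, inv_pow, Real.sq_sqrt (by positivity)]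
  field_simp

theorem abs_sub_min_le {K : ℝ} (hK : 0 < K) (x : ℝ) : |(|x| - min |x| K)| ≤ x ^ 2 / K := by
  rw [abs_of_nonneg (sub_nonneg.2 (min_le_left _ _))]
  rcases le_total |x| K with h | h
  · rw [min_eq_left h, sub_self]
    positivity
  · rw [min_eq_right h, le_div_iff₀ hK, ← sq_abs]
    nlinarith [abs_nonneg x]

/-- Quantitative uniform integrability: convergence in law controls only bounded continuous
functions, and this bounds the cost of truncating `|Z|` at `K`. -/
theorem abs_integral_abs_sub_integral_min_le {Ω : Type*} [MeasurableSpace Ω] {P : Measure Ω}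
    [IsProbabilityMeasure P] {Z : Ω → ℝ} (hZ : MemLp Z 2 P) {K : ℝ} (hK : 0 < K) :
    |(∫ ω, |Z ω| ∂P) - ∫ ω, min |Z ω| K ∂P| ≤ (∫ ω, Z ω ^ 2 ∂P) / K := by
  have i1 : Integrable (fun ω => |Z ω|) P := (hZ.integrable one_le_two).abs
  have i2 : Integrable (fun ω => min |Z ω| K) P := i1.inf (integrable_const K)
  rw [← integral_sub i1 i2, ← integral_div]
  exact abs_integral_le_integral_abs.trans (integral_mono (i1.sub i2).abs
    (hZ.integrable_sq.div_const K) fun ω => abs_sub_min_le hK _)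

variable {Ω : Type*} {Y : ℕ → Ω → ℝ} [mΩ : MeasurableSpace Ω] {P : Measure Ω}
  [IsProbabilityMeasure P] {v m : ℝ}

/-- The first absolute moment of a normalised centred walk converges to the Gaussian one. -/
theorem CenteredWalk.tendsto_integral_abs_sum (hw : CenteredWalk P Y v m) (hv : 0 < v) :
    Tendsto (fun n : ℕ => (∫ ω, |∑ k ∈ Finset.range n, Y k ω| ∂P) / √n) atTop
      (𝓝 √(2 * v / Real.pi)) := by
  have hvar : Var[Y 0; P] = v := by
    rw [variance_of_integral_eq_zero (hw.meas 0).aemeasurable hw.mean, hw.sq]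
  have hv0 : v.toNNReal ≠ 0 := by simpa using hv
  have hclt := tendstoInDistribution_inv_sqrt_mul_sum_sub (P := P) (X := Y)
    (P' := gaussianReal 0 Var[Y 0; P].toNNReal) (Y := id) HasLaw.id hw.memLp hw.indep hw.ident
  rw [hvar] at hclt
  have hmean0 : ∫ ω, Y 0 ω ∂P = 0 := hw.mean
  set Z : ℕ → Ω → ℝ := fun n ω => (√n)⁻¹ * ∑ k ∈ Finset.range n, Y k ω with hZ
  have hZmem : ∀ n, MemLp (Z n) 2 P := fun n => (hw.memLp_sum n).const_mul _
  have hZsq : ∀ n, ∫ ω, Z n ω ^ 2 ∂P ≤ v := by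
    intro n
    have h1 := (integral_sq_transform hw.meas hw.indep hw.memLp' hw.mean' hw.sq'
      (c := fun _ _ => 1) (fun _ => measurable_const) (by simp) n).2
    simp only [one_mul, one_pow, Finset.sum_const, Finset.card_range, nsmul_eq_mul, mul_one,
      integral_const, probReal_univ, smul_eq_mul] at h1
    simp only [hZ, mul_pow]
    rw [integral_const_mul, h1, inv_pow, Real.sq_sqrt (Nat.cast_nonneg n)]
    rcases Nat.eq_zero_or_pos n with rfl | hn
    · simpa using hv.le
    · have : (0 : ℝ) < n := by exact_mod_cast hn
      exact le_of_eq (by field_simp)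
  have hGmem : MemLp (fun x : ℝ => x) 2 (gaussianReal 0 v.toNNReal) := memLp_id_gaussianReal 2
  have hGsq : ∫ x, x ^ 2 ∂(gaussianReal 0 v.toNNReal) = v := by
    rw [← variance_of_integral_eq_zero (X := fun x : ℝ => x) (by fun_prop)
      integral_id_gaussianReal, variance_fun_id_gaussianReal, Real.coe_toNNReal _ hv.le]
  have hG := integral_abs_gaussianReal hv0
  rw [Real.coe_toNNReal _ hv.le] at hG
  rw [← hG]
  have hbdd : ∀ K : ℝ, 0 < K → Tendsto (fun n => ∫ ω, min |Z n ω| K ∂P) atTop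
      (𝓝 (∫ x, min |x| K ∂(gaussianReal 0 v.toNNReal))) := by
    intro K hK
    have hc : Continuous fun x : ℝ => min |x| K := by fun_prop
    let f : BoundedContinuousFunction ℝ ℝ := BoundedContinuousFunction.ofNormedAddCommGroup
      (fun x : ℝ => min |x| K) hc K (fun x => by
        rw [Real.norm_eq_abs, abs_of_nonneg (le_min (abs_nonneg _) hK.le)]
        exact min_le_right _ _)
    have h := ProbabilityMeasure.tendsto_iff_forall_integral_tendsto.1 hclt.tendsto f
    simp only [ProbabilityMeasure.coe_mk, Measure.map_id] at h
    refine h.congr fun n => ?_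
    rw [integral_map (hclt.forall_aemeasurable n) f.continuous.aestronglyMeasurable]
    simp [f, hZ, hmean0]
  have hlim : Tendsto (fun n => ∫ ω, |Z n ω| ∂P) atTop
      (𝓝 (∫ x, |x| ∂(gaussianReal 0 v.toNNReal))) := by
    rw [Metric.tendsto_atTop]
    intro ε hε
    -- The `+ 1` makes `v / K < ε / 3` strict; the other two thirds pay for the limit law's
    -- truncation and for the convergence at level `K`.
    set K := 3 * (v + 1) / ε with hKdef
    have hK : 0 < K := by positivity
    have hvK : v / K < ε / 3 := by
      rw [hKdef, div_div_eq_mul_div, div_lt_div_iff₀ (by positivity) (by norm_num)]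
      nlinarith
    obtain ⟨N, hN⟩ := Metric.tendsto_atTop.1 (hbdd K hK) (ε / 3) (by positivity)
    refine ⟨N, fun n hn => ?_⟩
    have h1 := abs_integral_abs_sub_integral_min_le (hZmem n) hK
    have h2 := abs_integral_abs_sub_integral_min_le hGmem hK
    have h3 := hN n hn
    rw [Real.dist_eq] at h3 ⊢
    rw [hGsq] at h2
    have h4 : (∫ ω, Z n ω ^ 2 ∂P) / K ≤ v / K := by gcongr; exact hZsq n
    rw [abs_le] at h1 h2
    rw [abs_lt] at h3 ⊢
    constructor <;> linarith
  refine hlim.congr fun n => ?_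
  simp only [hZ, abs_mul, abs_inv, abs_of_nonneg (Real.sqrt_nonneg _)]
  rw [integral_const_mul, inv_mul_eq_div]

/-- The boundary curve of two half-planes through the origin. -/
def wedge (g₀ g₁ s : ℝ) : ℝ := max (-(g₀ * s)) (-(g₁ * s))

/-- Splits off the odd part, whose mean vanishes along a centred walk. -/
theorem wedge_eq {g₀ g₁ : ℝ} (hg : g₀ ≤ g₁) (s : ℝ) :
    wedge g₀ g₁ s = (g₁ - g₀) / 2 * |s| - (g₀ + g₁) / 2 * s := by
  rcases le_total 0 s with hs | hs
  · rw [wedge, abs_of_nonneg hs, max_eq_left (by nlinarith)]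
    ring
  · rw [wedge, abs_of_nonpos hs, max_eq_right (by nlinarith)]
    ring

theorem abs_wedge_sub_le {g₀ g₁ : ℝ} (s t : ℝ) :
    |wedge g₀ g₁ s - wedge g₀ g₁ t| ≤ (|g₀| + |g₁|) * |s - t| := by
  refine (abs_max_sub_max_le_max _ _ _ _).trans (max_le ?_ ?_)
  · rw [show -(g₀ * s) - -(g₀ * t) = -(g₀ * (s - t)) by ring, abs_neg, abs_mul]
    gcongr
    linarith [abs_nonneg g₁]
  · rw [show -(g₁ * s) - -(g₁ * t) = -(g₁ * (s - t)) by ring, abs_neg, abs_mul]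
    gcongr
    linarith [abs_nonneg g₀]

theorem measurable_wedge {g₀ g₁ : ℝ} : Measurable (wedge g₀ g₁) := by
  unfold wedge
  fun_prop

theorem CenteredWalk.integral_wedge_sum (hw : CenteredWalk P Y v m) {g₀ g₁ : ℝ} (hg : g₀ ≤ g₁)
    (n : ℕ) : ∫ ω, wedge g₀ g₁ (∑ k ∈ Finset.range n, Y k ω) ∂P =
      (g₁ - g₀) / 2 * ∫ ω, |∑ k ∈ Finset.range n, Y k ω| ∂P := by
  have i1 := (hw.memLp_sum n).integrable one_le_two
  have hz : ∫ ω, ∑ k ∈ Finset.range n, Y k ω ∂P = 0 := by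
    rw [integral_finsetSum _ fun k _ => (hw.memLp' k).integrable one_le_two]
    exact Finset.sum_eq_zero fun k _ => hw.mean' k
  simp_rw [wedge_eq hg]
  rw [integral_sub (i1.abs.const_mul _) (i1.const_mul _), integral_const_mul, integral_const_mul,
    hz]
  ring

/-- Second-order asymptotics of the expected passage time over a wedge-shaped boundary. -/
theorem CenteredWalk.tendsto_expected_passageTime (hw : CenteredWalk P Y v m) (hv : 0 < v)
    {g₀ g₁ : ℝ} (hg : g₀ ≤ g₁) :
    Tendsto (fun a : ℝ =>
      ((∫⁻ ω, (passageTime (wedge g₀ g₁) a Y ω : ℝ≥0∞) ∂P).toReal - a) / √a) atTop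
      (𝓝 ((g₁ - g₀) * √(v / (2 * Real.pi)))) := by
  obtain ⟨D, hD⟩ := hw.abs_expected_passageTime_sub_le hv measurable_wedge
    (by simp [wedge]) (abs_wedge_sub_le (g₀ := g₀) (g₁ := g₁)) (by positivity)
  have hq : Tendsto (fun a : ℝ => √(√a)) atTop atTop :=
    Real.tendsto_sqrt_atTop.comp Real.tendsto_sqrt_atTop
  have hmain : Tendsto (fun a : ℝ =>
      (∫ ω, wedge g₀ g₁ (∑ k ∈ Finset.range ⌊a⌋₊, Y k ω) ∂P) / √a) atTop
      (𝓝 ((g₁ - g₀) * √(v / (2 * Real.pi)))) := by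
    have h1 := (hw.tendsto_integral_abs_sum hv).comp (tendsto_nat_floor_atTop (α := ℝ))
    -- Converts the normalisation `√⌊a⌋` into `√a`.
    have h2 : Tendsto (fun a : ℝ => √((⌊a⌋₊ : ℝ) / a)) atTop (𝓝 1) := by
      simpa using (tendsto_nat_floor_div_atTop (R := ℝ)).sqrt
    have h3 := (h1.mul h2).const_mul ((g₁ - g₀) / 2)
    have e : (g₁ - g₀) / 2 * (√(2 * v / Real.pi) * 1) = (g₁ - g₀) * √(v / (2 * Real.pi)) := by
      have : 2 * v / Real.pi = 2 ^ 2 * (v / (2 * Real.pi)) := by field_simp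
      rw [this, Real.sqrt_mul (by positivity), Real.sqrt_sq (by norm_num)]
      ring
    rw [e] at h3
    refine h3.congr' ?_
    filter_upwards [eventually_ge_atTop 1] with a ha
    have hn : (0 : ℝ) < (⌊a⌋₊ : ℝ) := by exact_mod_cast Nat.floor_pos.2 ha
    have ha0 : 0 < a := by linarith
    rw [hw.integral_wedge_sum hg, Real.sqrt_div hn.le]
    simp only [Function.comp_apply]
    have := (Real.sqrt_pos.2 hn).ne'
    have := (Real.sqrt_pos.2 ha0).ne'
    field_simp
  have hrem : Tendsto (fun a : ℝ =>
      ((∫⁻ ω, (passageTime (wedge g₀ g₁) a Y ω : ℝ≥0∞) ∂P).toReal - a -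
        ∫ ω, wedge g₀ g₁ (∑ k ∈ Finset.range ⌊a⌋₊, Y k ω) ∂P) / √a) atTop (𝓝 0) := by
    have h0 : Tendsto (fun a : ℝ => D / √(√a)) atTop (𝓝 0) := hq.const_div_atTop D
    refine squeeze_zero_norm' ?_ h0
    filter_upwards [eventually_ge_atTop 1] with a ha
    have h1 : 1 ≤ √(√a) := by simpa using ha
    have h2 : √(√a) ^ 2 = √a := Real.sq_sqrt (Real.sqrt_nonneg _)
    have h4 : √(√a) ^ 4 = a := by
      rw [show √(√a) ^ 4 = (√(√a) ^ 2) ^ 2 by ring, h2, Real.sq_sqrt (by linarith)]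
    have h := hD _ h1
    rw [h4] at h
    have h0' : 0 < √(√a) := by linarith
    rw [Real.norm_eq_abs, abs_div, abs_of_nonneg (Real.sqrt_nonneg a)]
    generalize √(√a) = q at h h2 h0' ⊢
    rw [← h2, div_le_div_iff₀ (by positivity) h0']
    calc _ ≤ D * q * q := by gcongr
      _ = _ := by ring
  have := hrem.add hmain
  rw [zero_add] at this
  refine this.congr fun a => ?_
  ring

end FirstPassage

/-! ### Exponential families: moments, strict convexity of `b`, monotonicity of `(lam - θ) / I(lam,
θ)`. -/

namespace ExpFamily

variable {F : Measure ℝ} {ξ θ lam : ℝ}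

/-- Gives access to the mean, variance and integrability of tilted measures in terms of `cgf`. -/
theorem law_eq_tilted (hF : F ≠ 0) (hξ : ξ ∈ naturalParameters F) :
    law F ξ = F.tilted (ξ * id ·) := by
  have hi : Integrable (fun x : ℝ => Real.exp (ξ * id x)) F := hξ
  have hpos : 0 < mgf id F ξ := mgf_pos' hF hi
  rw [law, Measure.tilted]
  congr 1
  ext x
  rw [density, b, cgf, Real.exp_sub, Real.exp_log hpos]
  rfl

theorem log_density_div (x : ℝ) :
    Real.log (density F lam x / density F θ x) = (lam - θ) * x - (b F lam - b F θ) := by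
  rw [density, density, ← Real.exp_sub, Real.log_exp]
  ring

theorem ne_zero_of_not_concentrated (hF : ∀ c : ℝ, F {c}ᶜ ≠ 0) : F ≠ 0 := by
  rintro rfl
  exact hF 0 rfl

theorem interior_subset_naturalParameters (hξ : ξ ∈ interior (naturalParameters F)) :
    ξ ∈ naturalParameters F := interior_subset (s := naturalParameters F) hξ

/-- Zero variance would concentrate the tilted law at its mean, and `F` with it, since `F` is
absolutely continuous with respect to the tilted law. -/
theorem variance_law_pos (hF : ∀ c : ℝ, F {c}ᶜ ≠ 0) (hξ : ξ ∈ interior (naturalParameters F)) :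
    0 < iteratedDeriv 2 (b F) ξ := by
  have hF0 := ne_zero_of_not_concentrated hF
  have hξ' := interior_subset_naturalParameters hξ
  have hprob := isProbabilityMeasure_law F hF0 hξ'
  rw [law_eq_tilted hF0 hξ'] at hprob
  have hvar := variance_tilted_mul hξ
  have hb : iteratedDeriv 2 (b F) ξ = iteratedDeriv 2 (cgf id F) ξ := rfl
  rw [hb, ← hvar]
  refine lt_of_le_of_ne (variance_nonneg _ _) fun h0 => ?_
  have hae := ae_eq_integral_of_variance_eq_zero (memLp_tilted_mul hξ 2) h0.symm
  have hac : F ≪ F.tilted (ξ * id ·) := absolutelyContinuous_tilted hξ'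
  exact hF _ (hac.ae_le hae)

theorem strictConvexOn_b (hF : ∀ c : ℝ, F {c}ᶜ ≠ 0) :
    StrictConvexOn ℝ (interior (naturalParameters F)) (b F) := by
  refine strictConvexOn_of_deriv2_pos' convex_integrableExpSet.interior
    analyticOn_cgf.continuousOn fun x hx => ?_
  rw [← iteratedDeriv_eq_iterate]
  exact variance_law_pos hF hx

theorem hasDerivAt_b (hξ : ξ ∈ interior (naturalParameters F)) :
    HasDerivAt (b F) (deriv (b F) ξ) ξ :=
  (analyticAt_cgf hξ).differentiableAt.hasDerivAt

theorem integral_law (hF : F ≠ 0) (hξ : ξ ∈ interior (naturalParameters F)) :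
    ∫ x, x ∂(law F ξ) = deriv (b F) ξ := by
  rw [law_eq_tilted hF (interior_subset_naturalParameters hξ)]
  exact integral_tilted_mul_self hξ

theorem memLp_law (hF : F ≠ 0) (hξ : ξ ∈ interior (naturalParameters F)) (p : NNReal) :
    MemLp (fun x => x) p (law F ξ) := by
  rw [law_eq_tilted hF (interior_subset_naturalParameters hξ)]
  exact memLp_tilted_mul hξ p

theorem variance_law (hF : F ≠ 0) (hξ : ξ ∈ interior (naturalParameters F)) :
    Var[fun x => x; law F ξ] = iteratedDeriv 2 (b F) ξ := by
  rw [law_eq_tilted hF (interior_subset_naturalParameters hξ)]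
  exact variance_tilted_mul hξ

theorem info_eq (hF : F ≠ 0) (hlam : lam ∈ interior (naturalParameters F)) :
    info F lam θ = (lam - θ) * deriv (b F) lam - (b F lam - b F θ) := by
  have := isProbabilityMeasure_law F hF (interior_subset_naturalParameters hlam)
  have hi : Integrable (fun x : ℝ => x) (law F lam) :=
    memLp_one_iff_integrable.1 (by simpa using memLp_law hF hlam 1)
  simp_rw [info, log_density_div]
  rw [integral_sub (hi.const_mul _) (integrable_const _), integral_const_mul,
    integral_law hF hlam]
  simp

theorem info_pos (hF : ∀ c : ℝ, F {c}ᶜ ≠ 0) (hlam : lam ∈ interior (naturalParameters F))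
    (hθ : θ ∈ interior (naturalParameters F)) (h : θ < lam) : 0 < info F lam θ := by
  rw [info_eq (ne_zero_of_not_concentrated hF) hlam]
  have := (strictConvexOn_b hF).slope_lt_of_hasDerivAt hθ hlam h (hasDerivAt_b hlam)
  rw [slope_def_field, div_lt_iff₀ (sub_pos.2 h)] at this
  linarith

/-- The reciprocal `I(lam, θ) / (lam - θ)` is `b'(lam)` minus the slope of the secant of `b` between
`θ` and `lam`, and that slope is strictly increasing in `θ`. -/
theorem ratio_lt_ratio (hF : ∀ c : ℝ, F {c}ᶜ ≠ 0) (hlam : lam ∈ interior (naturalParameters F))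
    {θ' : ℝ} (hθ : θ ∈ interior (naturalParameters F))
    (hθ' : θ' ∈ interior (naturalParameters F)) (h : θ < θ') (h' : θ' < lam) :
    (lam - θ) / info F lam θ < (lam - θ') / info F lam θ' := by
  have hs := (strictConvexOn_b hF).secant_strict_mono hlam hθ hθ' (h.trans h').ne h'.ne h
  have h1 := info_pos hF hlam hθ (h.trans h')
  have h2 := info_pos hF hlam hθ' h'
  rw [div_lt_div_iff₀ h1 h2]
  rw [← neg_div_neg_eq, ← neg_div_neg_eq (b F θ' - b F lam),
    div_lt_div_iff₀ (by linarith) (by linarith)] at hs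
  rw [info_eq (ne_zero_of_not_concentrated hF) hlam, info_eq (ne_zero_of_not_concentrated hF) hlam]
  nlinarith

end ExpFamily

/-! ### Reduction of `M(a)` to a passage time, and the likelihood ratio identity. -/

namespace ExpFamily

open FirstPassage

variable {F : Measure ℝ} {θ θ₀ θ₁ lam : ℝ}

/-- The centred observations. -/
noncomputable def centered (F : Measure ℝ) (lam : ℝ) (k : ℕ) (x : ℕ → ℝ) : ℝ := x k - deriv (b F) lam

theorem measurable_centered (k : ℕ) : Measurable (centered F lam k) :=
  (measurable_pi_apply k).sub_const _

theorem centeredWalk_seqLaw (hF : F ≠ 0) (hlam : lam ∈ interior (naturalParameters F)) :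
    CenteredWalk (seqLaw F lam) (centered F lam) (iteratedDeriv 2 (b F) lam)
      (∫ x, (x - deriv (b F) lam) ^ 4 ∂(law F lam)) := by
  have hprob := isProbabilityMeasure_law F hF (interior_subset_naturalParameters hlam)
  have hp : IsProbabilityMeasure (seqLaw F lam) := by unfold seqLaw; infer_instance
  have hmap : ∀ k, (seqLaw F lam).map (fun x => x k) = law F lam :=
    fun k => Measure.infinitePi_map_eval _ k
  have hmp : ∀ k, MeasurePreserving (fun x : ℕ → ℝ => x k) (seqLaw F lam) (law F lam) :=
    fun k => ⟨measurable_pi_apply k, hmap k⟩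
  have hint : ∀ f : ℝ → ℝ, Measurable f →
      ∫ x, f (x 0) ∂(seqLaw F lam) = ∫ y, f y ∂(law F lam) := fun f hf => by
    rw [← hmap 0, integral_map (measurable_pi_apply 0).aemeasurable hf.aestronglyMeasurable]
  have hi : Integrable (fun x : ℝ => x) (law F lam) :=
    memLp_one_iff_integrable.1 (by simpa using memLp_law hF hlam 1)
  refine ⟨measurable_centered, ?_, fun k => ?_, ?_, ?_, ?_, ?_, ?_⟩
  · exact iIndepFun_infinitePi (X := fun _ y => y - deriv (b F) lam)
      fun _ => measurable_id.sub_const _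
  · have h : IdentDistrib (fun x : ℕ → ℝ => x k) (fun x => x 0) (seqLaw F lam) (seqLaw F lam) :=
      ⟨(measurable_pi_apply k).aemeasurable, (measurable_pi_apply 0).aemeasurable,
        by rw [hmap, hmap]⟩
    exact h.comp (u := fun y => y - deriv (b F) lam) (by fun_prop)
  · exact ((memLp_law hF hlam 2).sub (memLp_const _)).comp_measurePreserving (hmp 0)
  · refine (hint (fun y => y - deriv (b F) lam) (by fun_prop)).trans ?_
    rw [integral_sub hi (integrable_const _), integral_law hF hlam]
    simp
  · refine (hint (fun y => (y - deriv (b F) lam) ^ 2) (by fun_prop)).trans ?_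
    rw [← variance_law hF hlam, variance_eq_integral (by fun_prop), integral_law hF hlam]
  · have h4 : MemLp (fun y : ℝ => y - deriv (b F) lam) 4 (law F lam) :=
      (memLp_law hF hlam 4).sub (memLp_const _)
    have h5 := h4.integrable_norm_pow (p := 4) (by norm_num)
    have h6 : Integrable (fun y : ℝ => (y - deriv (b F) lam) ^ 4) (law F lam) := by
      refine h5.congr (Eventually.of_forall fun y => ?_)
      simp only [Real.norm_eq_abs]
      rw [← abs_pow, abs_of_nonneg (by positivity)]
    exact (hmp 0).integrable_comp_of_integrable h6
  · exact hint (fun y => (y - deriv (b F) lam) ^ 4) (by fun_prop)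

theorem sum_log_density_div (hF : F ≠ 0) (hlam : lam ∈ interior (naturalParameters F)) (n : ℕ)
    (x : ℕ → ℝ) :
    ∑ i ∈ Finset.range n, Real.log (density F lam (x i) / density F θ (x i)) =
      (lam - θ) * ∑ i ∈ Finset.range n, centered F lam i x + n * info F lam θ := by
  simp_rw [log_density_div, centered]
  rw [info_eq hF hlam, Finset.sum_sub_distrib, Finset.sum_sub_distrib, ← Finset.mul_sum]
  simp
  ring

/-- It suffices to check the stopping rule at the two endpoints. -/
theorem M_eq_passageTime (hF : ∀ c : ℝ, F {c}ᶜ ≠ 0)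
    (hlam : lam ∈ interior (naturalParameters F))
    (hU : ∀ θ ∈ Set.Icc θ₀ θ₁, θ ∈ interior (naturalParameters F)) (h₀₁ : θ₀ < θ₁)
    (h₁ : θ₁ < lam) (a : ℝ) :
    M F θ₀ θ₁ lam a = passageTime (wedge ((lam - θ₀) / info F lam θ₀)
      ((lam - θ₁) / info F lam θ₁)) a (centered F lam) := by
  have hF0 := ne_zero_of_not_concentrated hF
  ext1 x
  unfold M passageTime firstTime
  have key : ∀ n : ℕ, (∀ θ ∈ Set.Icc θ₀ θ₁, info F lam θ * a ≤
      ∑ i ∈ Finset.range n, Real.log (density F lam (x i) / density F θ (x i))) ↔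
      a + wedge ((lam - θ₀) / info F lam θ₀) ((lam - θ₁) / info F lam θ₁)
        (∑ k ∈ Finset.range n, centered F lam k x) ≤ n := by
    intro n
    set S := ∑ k ∈ Finset.range n, centered F lam k x with hS
    have h1 : ∀ θ ∈ Set.Icc θ₀ θ₁, (info F lam θ * a ≤
      ∑ i ∈ Finset.range n, Real.log (density F lam (x i) / density F θ (x i)) ↔
        a - (lam - θ) / info F lam θ * S ≤ n) := by
      intro θ hθ
      have hI := info_pos hF hlam (hU θ hθ) (hθ.2.trans_lt h₁)
      rw [sum_log_density_div hF0 hlam, ← hS, ← mul_le_mul_iff_right₀ hI (b := a - _)]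
      have : info F lam θ * (a - (lam - θ) / info F lam θ * S) =
          info F lam θ * a - (lam - θ) * S := by field_simp
      rw [this]
      constructor <;> intro h <;> linarith
    have m₀ : θ₀ ∈ Set.Icc θ₀ θ₁ := ⟨le_rfl, h₀₁.le⟩
    have m₁ : θ₁ ∈ Set.Icc θ₀ θ₁ := ⟨h₀₁.le, le_rfl⟩
    have h2 : (a + wedge ((lam - θ₀) / info F lam θ₀) ((lam - θ₁) / info F lam θ₁) S ≤ n) ↔
        (a - (lam - θ₀) / info F lam θ₀ * S ≤ n ∧ a - (lam - θ₁) / info F lam θ₁ * S ≤ n) := by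
      rw [wedge, ← le_sub_iff_add_le', max_le_iff]
      constructor
      · rintro ⟨u, w⟩
        constructor <;> linarith
      · rintro ⟨u, w⟩
        constructor <;> linarith
    rw [h2]
    refine ⟨fun h => ⟨(h1 _ m₀).1 (h _ m₀), (h1 _ m₁).1 (h _ m₁)⟩, fun ⟨u, w⟩ θ hθ => ?_⟩
    refine (h1 θ hθ).2 ?_
    have g₀ : (lam - θ₀) / info F lam θ₀ ≤ (lam - θ) / info F lam θ := by
      rcases hθ.1.eq_or_lt with h | h
      · rw [h]
      · exact (ratio_lt_ratio hF hlam (hU _ m₀) (hU _ hθ) h (hθ.2.trans_lt h₁)).le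
    have g₁ : (lam - θ) / info F lam θ ≤ (lam - θ₁) / info F lam θ₁ := by
      rcases hθ.2.eq_or_lt with h | h
      · rw [h]
      · exact (ratio_lt_ratio hF hlam (hU _ hθ) (hU _ m₁) h h₁).le
    -- For fixed `S` the bound is affine in the ratio: `θ₀` is the worst case when `S ≥ 0`, and `θ₁`
    -- when `S ≤ 0`.
    rcases le_total 0 S with hs | hs
    · have := mul_le_mul_of_nonneg_right g₀ hs
      linarith
    · have := mul_le_mul_of_nonpos_right g₁ hs
      linarith
  simp_rw [key]

/-- The likelihood ratio of one observation. -/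
noncomputable def ratio (F : Measure ℝ) (lam θ y : ℝ) : ℝ≥0∞ :=
  ENNReal.ofReal (Real.exp (-((lam - θ) * y - (b F lam - b F θ))))

theorem measurable_ratio : Measurable (ratio F lam θ) := by
  unfold ratio
  fun_prop

theorem law_eq_withDensity_ratio : law F θ = (law F lam).withDensity (ratio F lam θ) := by
  have hd : ∀ ξ : ℝ, Measurable fun x => ENNReal.ofReal (density F ξ x) := fun ξ => by
    unfold density
    fun_prop
  rw [law, law, ← withDensity_mul _ (hd lam) measurable_ratio]
  congr 1
  ext x
  rw [Pi.mul_apply, ratio, ← ENNReal.ofReal_mul (by rw [density]; positivity), density, density,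
    ← Real.exp_add]
  congr 2
  ring

/-- The likelihood ratio identity on events determined by the first `n` observations. -/
theorem seqLaw_preimage_restrict (hF : F ≠ 0) (hlam : lam ∈ naturalParameters F)
    (hθ : θ ∈ naturalParameters F) (n : ℕ) {A : Set (Finset.range n → ℝ)}
    (hA : MeasurableSet A) :
    seqLaw F θ ((Finset.range n).restrict ⁻¹' A) =
      ∫⁻ x in (Finset.range n).restrict ⁻¹' A, ∏ i ∈ Finset.range n, ratio F lam θ (x i)
        ∂(seqLaw F lam) := by
  have p1 := isProbabilityMeasure_law F hF hlam
  have p2 := isProbabilityMeasure_law F hF hθ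
  have hres : Measurable ((Finset.range n).restrict : (ℕ → ℝ) → Finset.range n → ℝ) := by fun_prop
  have hkey : Measure.pi (fun _ : Finset.range n => law F θ) =
      ((seqLaw F lam).withDensity fun x => ∏ i ∈ Finset.range n, ratio F lam θ (x i)).map
        (Finset.range n).restrict := by
    refine Measure.pi_eq fun s hs => ?_
    rw [Measure.map_apply hres (MeasurableSet.univ_pi hs),
      withDensity_apply _ (hres (MeasurableSet.univ_pi hs)),
      ← lintegral_indicator (hres (MeasurableSet.univ_pi hs))]
    -- Extending the rectangle's sides to all indices turns the integrand into a product of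
    -- functions of independent coordinates.
    let s' : ℕ → Set ℝ := fun i => if h : i ∈ Finset.range n then s ⟨i, h⟩ else Set.univ
    have hs' : ∀ i, MeasurableSet (s' i) := fun i => by
      simp only [s']
      split_ifs with h
      · exact hs _
      · exact MeasurableSet.univ
    have hss : ∀ i : Finset.range n, s' i = s i := fun i => by
      simp [s', Finset.mem_range.1 i.2]
    have hf : ∀ i, Measurable ((s' i).indicator (ratio F lam θ)) :=
      fun i => measurable_ratio.indicator (hs' i)
    have e : ∀ x : ℕ → ℝ, ((Finset.range n).restrict ⁻¹' Set.univ.pi s).indicator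
        (fun x => ∏ i ∈ Finset.range n, ratio F lam θ (x i)) x =
        ∏ i ∈ Finset.range n, (s' i).indicator (ratio F lam θ) (x i) := by
      intro x
      by_cases hx : x ∈ (Finset.range n).restrict ⁻¹' Set.univ.pi s
      · rw [Set.indicator_of_mem hx]
        refine Finset.prod_congr rfl fun i hi => ?_
        rw [Set.indicator_of_mem]
        have := hx ⟨i, hi⟩ trivial
        rwa [← hss ⟨i, hi⟩] at this
      · rw [Set.indicator_of_notMem hx]
        simp only [Set.mem_preimage, Set.mem_pi, not_forall] at hx
        obtain ⟨i, -, hi⟩ := hx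
        rw [← hss i] at hi
        exact (Finset.prod_eq_zero i.2 (Set.indicator_of_notMem hi _)).symm
    simp_rw [e]
    have hind : iIndepFun (fun i (x : ℕ → ℝ) => (s' i).indicator (ratio F lam θ) (x i))
      (seqLaw F lam) := iIndepFun_infinitePi hf
    rw [lintegral_prod_eq_prod_lintegral_of_indepFun _ _ hind
      fun i => (hf i).comp (measurable_pi_apply i), ← Finset.prod_coe_sort]
    refine Finset.prod_congr rfl fun i _ => ?_
    rw [← hss i, law_eq_withDensity_ratio (lam := lam), withDensity_apply _ (hs' _),
      ← lintegral_indicator (hs' _)]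
    have hmap : (seqLaw F lam).map (fun x => x i) = law F lam :=
      Measure.infinitePi_map_eval _ _
    conv_rhs => rw [← hmap]
    rw [lintegral_map (hf _) (measurable_pi_apply _)]
  have h2 : (seqLaw F θ).map (Finset.range n).restrict =
      Measure.pi (fun _ : Finset.range n => law F θ) := Measure.infinitePi_map_restrict _
  rw [← Measure.map_apply hres hA, h2, hkey, Measure.map_apply hres hA,
    withDensity_apply _ (hres hA)]

theorem prod_ratio (n : ℕ) (x : ℕ → ℝ) : ∏ i ∈ Finset.range n, ratio F lam θ (x i) = ENNReal.ofReal (Real.exp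
      (-∑ i ∈ Finset.range n, Real.log (density F lam (x i) / density F θ (x i)))) := by
  simp_rw [ratio, log_density_div]
  rw [← ENNReal.ofReal_prod_of_nonneg fun _ _ => by positivity, ← Real.exp_sum,
    Finset.sum_neg_distrib]

/-- Passes from stopping events, which live in `past`, to the cylinder sets of
`seqLaw_preimage_restrict`. -/
theorem exists_preimage_restrict {n : ℕ} {E : Set (ℕ → ℝ)}
    (hE : MeasurableSet[past (centered F lam) n] E) :
    ∃ A : Set (Finset.range n → ℝ), MeasurableSet A ∧ (Finset.range n).restrict ⁻¹' A = E := by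
  have hle : past (centered F lam) n ≤
      MeasurableSpace.comap ((Finset.range n).restrict : (ℕ → ℝ) → Finset.range n → ℝ)
        inferInstance := by
    refine iSup₂_le fun j hj => ?_
    rw [← measurable_iff_comap_le]
    have : centered F lam j = (fun z : Finset.range n → ℝ =>
        z ⟨j, Finset.mem_range.2 hj⟩ - deriv (b F) lam) ∘ (Finset.range n).restrict := rfl
    rw [this]
    exact Measurable.comp (by fun_prop) (comap_measurable _)
  exact hle _ hE

end ExpFamily

namespace FirstPassage

theorem IsStop.measurableSet_eq {Ω : Type*} {Y : ℕ → Ω → ℝ} {T : Ω → ℕ∞} (hT : IsStop Y T)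
    (n : ℕ) : MeasurableSet[past Y n] {ω | T ω = n} := by
  have hn : MeasurableSet[past Y n] {ω | (n : ℕ∞) < T ω}ᶜ :=
    @MeasurableSet.compl _ _ (past Y n) (hT n)
  cases n with
  | zero =>
    convert! hn using 1
    ext ω
    simp
  | succ k =>
    have hk : MeasurableSet[past Y (k + 1)] {ω | (k : ℕ∞) < T ω} :=
      past_mono k.le_succ _ (hT k)
    convert! @MeasurableSet.inter _ (past Y (k + 1)) _ _ hk hn using 1
    ext ω
    simp only [Set.mem_ofPred_eq, Set.mem_inter_iff, Set.mem_compl_iff, not_lt]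
    rw [← ENat.add_one_le_iff (ENat.natCast_ne_top k), le_antisymm_iff, and_comm]
    norm_cast

end FirstPassage

/-! ### Change of measure for the stopping probability. -/

namespace ExpFamily

open FirstPassage

variable {F : Measure ℝ} {θ θ₀ θ₁ lam : ℝ}

/-- The exponential bound for the probability of stopping, which is nevertheless positive. -/
theorem stopProb_bounds (hF : F ≠ 0) (hlam : lam ∈ naturalParameters F)
    (hθn : θ ∈ naturalParameters F) (hθ : θ ∈ Set.Icc θ₀ θ₁) {a : ℝ}
    (hT : IsStop (centered F lam) (M F θ₀ θ₁ lam a))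
    (hfin : ∀ᵐ x ∂(seqLaw F lam), M F θ₀ θ₁ lam a x < ⊤) :
    0 < stopProb F θ₀ θ₁ lam a θ ∧
      stopProb F θ₀ θ₁ lam a θ ≤ Real.exp (-(info F lam θ * a)) := by
  have p1 := isProbabilityMeasure_law F hF hlam
  have p2 := isProbabilityMeasure_law F hF hθn
  have q1 : IsProbabilityMeasure (seqLaw F lam) := by unfold seqLaw; infer_instance
  have q2 : IsProbabilityMeasure (seqLaw F θ) := by unfold seqLaw; infer_instance
  set E : ℕ → Set (ℕ → ℝ) := fun n => {x | M F θ₀ θ₁ lam a x = n} with hE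
  have hEm : ∀ n, MeasurableSet (E n) := fun n =>
    past_le measurable_centered n _ (hT.measurableSet_eq n)
  have hU : {x | M F θ₀ θ₁ lam a x < ⊤} = ⋃ n, E n := by
    ext x
    simp only [hE, Set.mem_ofPred_eq, Set.mem_iUnion, lt_top_iff_ne_top, ENat.ne_top_iff_exists]
    exact exists_congr fun n => eq_comm
  have hdisj : Pairwise (Function.onFun Disjoint E) := fun i j hij =>
    Set.disjoint_left.2 fun x hi hj => hij (Nat.cast_injective (R := ℕ∞) (hi.symm.trans hj))
  have hlr : ∀ n, seqLaw F θ (E n) = ∫⁻ x in E n, ENNReal.ofReal (Real.exp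
      (-∑ i ∈ Finset.range n, Real.log (density F lam (x i) / density F θ (x i))))
        ∂(seqLaw F lam) := by
    intro n
    obtain ⟨A, hA, hAE⟩ := exists_preimage_restrict (hT.measurableSet_eq n)
    have := seqLaw_preimage_restrict hF hlam hθn n hA
    simp_rw [prod_ratio] at this
    rwa [hAE] at this
  have hle : ∀ n, seqLaw F θ (E n) ≤
      ENNReal.ofReal (Real.exp (-(info F lam θ * a))) * seqLaw F lam (E n) := by
    intro n
    rw [hlr, ← setLIntegral_const]
    refine setLIntegral_mono measurable_const fun x hx => ?_
    have hp := prop_of_firstTime_eq (p := fun n => 1 ≤ n ∧ ∀ θ ∈ Set.Icc θ₀ θ₁, info F lam θ * a ≤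
      ∑ i ∈ Finset.range n, Real.log (density F lam (x i) / density F θ (x i))) hx
    exact ENNReal.ofReal_le_ofReal (Real.exp_le_exp.2 (neg_le_neg (hp.2 θ hθ)))
  have hone : seqLaw F lam (⋃ n, E n) = 1 := by
    rw [← hU]
    exact (mem_ae_iff_prob_eq_one (hU ▸ MeasurableSet.iUnion hEm)).1 hfin
  -- Strict positivity is essential: `Real.log 0 = 0`, so the logarithmic bound would fail for a
  -- null event. The likelihood ratio never vanishes, so if every `E n` were null under `θ`, every
  -- `E n` would be null under `lam`.
  have hpos : 0 < seqLaw F θ (⋃ n, E n) := by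
    rw [pos_iff_ne_zero]
    intro h0
    rw [measure_iUnion_null_iff] at h0
    have : seqLaw F lam (⋃ n, E n) = 0 := by
      refine measure_iUnion_null fun n => ?_
      by_contra hne
      have hm : Measurable fun x : ℕ → ℝ => ENNReal.ofReal (Real.exp
          (-∑ i ∈ Finset.range n, Real.log (density F lam (x i) / density F θ (x i)))) := by
        simp_rw [log_density_div]
        fun_prop
      have := (setLIntegral_pos_iff (μ := seqLaw F lam) hm (s := E n)).2 (by
        rw [Function.support_eq_univ fun x => (ENNReal.ofReal_pos.2 (Real.exp_pos _)).ne',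
          Set.univ_inter]
        exact pos_iff_ne_zero.2 hne)
      rw [← hlr, h0 n] at this
      exact lt_irrefl _ this
    rw [hone] at this
    exact one_ne_zero this
  have hbound : seqLaw F θ (⋃ n, E n) ≤ ENNReal.ofReal (Real.exp (-(info F lam θ * a))) := by
    calc seqLaw F θ (⋃ n, E n) ≤ ∑' n, seqLaw F θ (E n) := measure_iUnion_le _
      _ ≤ ∑' n, ENNReal.ofReal (Real.exp (-(info F lam θ * a))) * seqLaw F lam (E n) :=
        ENNReal.tsum_le_tsum hle
      _ = _ := by rw [ENNReal.tsum_mul_left, ← measure_iUnion hdisj hEm, hone, mul_one]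
  rw [stopProb, hU]
  exact ⟨ENNReal.toReal_pos hpos.ne' (measure_ne_top _ _),
    ENNReal.toReal_le_of_le_ofReal (Real.exp_pos _).le hbound⟩

end ExpFamily

theorem theorem2p1 (F : Measure ℝ) [SigmaFinite F]
    -- `F` is not concentrated at one point
    (hF : ∀ c : ℝ, F {c}ᶜ ≠ 0)
    -- the parameter interval `Ω = (ξlo, ξhi)`, possibly unbounded
    (ξlo ξhi : EReal)
    (hΩ : {ξ : ℝ | ξlo < (ξ : EReal) ∧ (ξ : EReal) < ξhi} ⊆ ExpFamily.naturalParameters F)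
    (θ₀ θ₁ lam : ℝ) (h₀ : ξlo < (θ₀ : EReal)) (h₀₁ : θ₀ < θ₁) (h₁ : θ₁ < lam)
    (hlam : (lam : EReal) < ξhi) :
    (∀ a : ℝ, 0 < a → ∀ θ ∈ Set.Icc θ₀ θ₁,
      a ≤ |Real.log (ExpFamily.stopProb F θ₀ θ₁ lam a θ)| / ExpFamily.info F lam θ) ∧
    (∃ r : ℝ → ℝ, Tendsto r atTop (𝓝 0) ∧ ∀ᶠ a : ℝ in atTop,
      ExpFamily.expectedM F θ₀ θ₁ lam a lam ≠ ∞ ∧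
      (ExpFamily.expectedM F θ₀ θ₁ lam a lam).toReal =
        a + (ExpFamily.C F θ₀ θ₁ lam + r a) * Real.sqrt a) ∧
    0 < ExpFamily.C F θ₀ θ₁ lam := by
  have hopen : IsOpen {ξ : ℝ | ξlo < (ξ : EReal) ∧ (ξ : EReal) < ξhi} :=
    (isOpen_Ioo (a := ξlo) (b := ξhi)).preimage continuous_coe_real_ereal
  -- Because `Ω` is open, all parameters in use are interior natural parameters, where `b` is
  -- analytic and all moments exist.
  have hsub := interior_maximal hΩ hopen
  have hmem : ∀ ξ ∈ Set.Icc θ₀ lam, ξ ∈ interior (ExpFamily.naturalParameters F) := fun ξ hξ =>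
    hsub ⟨h₀.trans_le (EReal.coe_le_coe_iff.2 hξ.1), (EReal.coe_le_coe_iff.2 hξ.2).trans_lt hlam⟩
  have hF0 := ExpFamily.ne_zero_of_not_concentrated hF
  have hlam' := hmem lam ⟨(h₀₁.trans h₁).le, le_rfl⟩
  have hU : ∀ θ ∈ Set.Icc θ₀ θ₁, θ ∈ interior (ExpFamily.naturalParameters F) :=
    fun θ hθ => hmem θ ⟨hθ.1, hθ.2.trans h₁.le⟩
  have hratio := ExpFamily.ratio_lt_ratio hF hlam' (hU θ₀ ⟨le_rfl, h₀₁.le⟩)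
    (hU θ₁ ⟨h₀₁.le, le_rfl⟩) h₀₁ h₁
  have hv := ExpFamily.variance_law_pos hF hlam'
  have hM := ExpFamily.M_eq_passageTime hF hlam' hU h₀₁ h₁
  have hw := ExpFamily.centeredWalk_seqLaw hF0 hlam'
  have hlamn := ExpFamily.interior_subset_naturalParameters hlam'
  have p1 := ExpFamily.isProbabilityMeasure_law F hF0 hlamn
  have q1 : IsProbabilityMeasure (ExpFamily.seqLaw F lam) := by
    unfold ExpFamily.seqLaw
    infer_instance
  have hfinite : ∀ a : ℝ, 0 < a → ExpFamily.expectedM F θ₀ θ₁ lam a lam ≠ ∞ := by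
    intro a ha
    rw [ExpFamily.expectedM, hM]
    exact ne_top_of_le_ne_top ENNReal.ofReal_ne_top
      (hw.lintegral_passageTime_le hv FirstPassage.measurable_wedge (by simp [FirstPassage.wedge])
        FirstPassage.abs_wedge_sub_le (by positivity) ha)
  have hC : ((lam - θ₁) / ExpFamily.info F lam θ₁ - (lam - θ₀) / ExpFamily.info F lam θ₀) *
      √(iteratedDeriv 2 (ExpFamily.b F) lam / (2 * Real.pi)) = ExpFamily.C F θ₀ θ₁ lam := rfl
  refine ⟨fun a ha θ hθ => ?_, ?_, ?_⟩
  · have hT : FirstPassage.IsStop (ExpFamily.centered F lam) (ExpFamily.M F θ₀ θ₁ lam a) := by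
      rw [hM]
      exact FirstPassage.isStop_passageTime FirstPassage.measurable_wedge a
    have hfin := hT.ae_lt_top ExpFamily.measurable_centered (hfinite a ha)
    obtain ⟨hpos, hle⟩ := ExpFamily.stopProb_bounds hF0 hlamn
      (ExpFamily.interior_subset_naturalParameters (hU θ hθ)) hθ hT hfin
    rw [le_div_iff₀ (ExpFamily.info_pos hF hlam' (hU θ hθ) (hθ.2.trans_lt h₁))]
    have hlog := (Real.log_le_iff_le_exp hpos).2 hle
    have := neg_le_abs (Real.log (ExpFamily.stopProb F θ₀ θ₁ lam a θ))
    linarith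
  -- The remainder is defined by solving the expansion for it; the identity is then algebra for `a >
  -- 0`.
  · refine ⟨fun a => ((ExpFamily.expectedM F θ₀ θ₁ lam a lam).toReal - a) / √a -
      ExpFamily.C F θ₀ θ₁ lam, ?_, ?_⟩
    · have h := hw.tendsto_expected_passageTime hv hratio.le
      simp_rw [← hM] at h
      rw [hC] at h
      simpa using! h.sub_const (ExpFamily.C F θ₀ θ₁ lam)
    · filter_upwards [eventually_gt_atTop 0] with a ha
      refine ⟨hfinite a ha, ?_⟩
      have := (Real.sqrt_pos.2 ha).ne'
      field_simp
      ring
  · rw [← hC]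
    exact mul_pos (sub_pos.2 hratio) (Real.sqrt_pos.2 (by positivity))
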